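/- Let $n\ge 0$ be an integer and let $\mathbb{R}_{0,n}$ be the real Clifford algebra generated by $e_1,\dots,e_n$ with $e_ie_j+e_je_i=-2\delta_{ij}$ (so $\mathbb{R}_{0,0}=\mathbb{R}$). Write each element as $c=\sum_A c_A e_A$ with $c_A\in\mathbb{R}$, where $A=\{h_1<\dots<h_r\}$ runs over the subsets of $\{1,\dots,n\}$, $e_A=e_{h_1}\cdots e_{h_r}$ and $e_\emptyset=1$; let $|c|=\big(\sum_A c_A^2\big)^{1/2}$, and let $c\mapsto\overline{c}$ be the Clifford conjugation (the linear anti-automorphism with $\overline{e_i}=-e_i$). Identify $x=(x_0,\dots,x_n)\in\mathbb{R}^{n+1}$ with the paravector $x_0+\sum_{i=1}^n x_ie_i\in\mathbb{R}_{0,n}$, so that $|x|$ is the Euclidean norm, and let $\mathbb{B}_{n+1}=\{x\in\mathbb{R}^{n+1}:|x|<1\}$. Let $f:\mathbb{B}_{n+1}\to\mathbb{R}_{0,n}$ be harmonic (that is, $f$ is $C^2$ and $\Delta f=0$) with $|f(x)|\le 1$ for all $x\in\mathbb{B}_{n+1}$, and suppose that $f(a)=0$ for some $a\in\mathbb{B}_{n+1}$.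 Then $$|f(x)|\le\frac{(1+|a|)^{n-1}}{\sqrt[n+1]{2}-1}\,\frac{|x-a|}{|1-\overline{a}x|^{n}},\qquad x\in\mathbb{B}_{n+1},$$ and moreover $$|\nabla f(a)|\le\frac{1}{\sqrt[n+1]{2}-1}\,\frac{1}{(1+|a|)(1-|a|)^{n}},$$ where $|\nabla f(a)|=\Big(\sum_{i=0}^{n}\big|\tfrac{\partial f}{\partial x_i}(a)\big|^2\Big)^{1/2}$. -/

import Mathlib

namespace CliffordHarmonic

/-- The quadratic form `v ↦ -(v₁² + ⋯ + vₙ²)` on `ℝⁿ`. -/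
noncomputable def negSq (n : ℕ) : QuadraticForm ℝ (Fin n → ℝ) :=
  QuadraticMap.weightedSumSquares ℝ (fun _ : Fin n => (-1 : ℝ))

/-- The real Clifford algebra `ℝ_{0,n}`, generated by `e₁, …, eₙ` subject to
`eᵢ eⱼ + eⱼ eᵢ = -2 δᵢⱼ`. -/
abbrev Cl (n : ℕ) : Type := CliffordAlgebra (negSq n)

/-- The imaginary unit `eᵢ` (the index set `{1, …, n}` is `Fin n`). -/
noncomputable def imUnit {n : ℕ} (i : Fin n) : Cl n :=
  CliffordAlgebra.ι (negSq n) (Pi.single i 1)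

/-- The product `e_A = e_{h₁} ⋯ e_{h_r}` for `A = {h₁ < ⋯ < h_r}`, with `e_∅ = 1`. -/
noncomputable def blade {n : ℕ} (A : Finset (Fin n)) : Cl n :=
  (A.sort.map imUnit).prod

theorem associated_neg_negSq_single {n : ℕ} (i j : Fin n) (h : i ≠ j) :
    QuadraticMap.associated (R := ℝ) (-negSq n) (Pi.single i 1) (Pi.single j 1) = 0 := by
  have key : ∀ v : Fin n → ℝ, (-negSq n) v = ∑ k, v k * v k := by
    intro v
    simp [negSq, QuadraticMap.weightedSumSquares_apply]
  have hs : ∀ k : Fin n, (Pi.single i 1 : Fin n → ℝ) k * (Pi.single j 1 : Fin n → ℝ) k = 0 := by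
    intro k
    by_cases hk : k = i
    · subst hk
      simp [Pi.single_eq_of_ne h]
    · simp [Pi.single_eq_of_ne hk]
  rw [QuadraticMap.associated_apply, key, key, key, ← Finset.sum_sub_distrib,
    ← Finset.sum_sub_distrib]
  rw [Finset.sum_eq_zero, smul_zero]
  intro k _
  have := hs k
  simp only [Pi.add_apply]
  linear_combination 2 * this

theorem contractLeft_prod_eq_zero {n : ℕ} (d : Module.Dual ℝ (Fin n → ℝ)) (l : List (Fin n))
    (h : ∀ j ∈ l, d (Pi.single j 1) = 0) :
    CliffordAlgebra.contractLeft d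
      ((l.map fun j => CliffordAlgebra.ι (0 : QuadraticForm ℝ (Fin n → ℝ))
        (Pi.single j 1)).prod) = 0 := by
  induction l with
  | nil => simp [CliffordAlgebra.contractLeft_one]
  | cons a t ih =>
    rw [List.map_cons, List.prod_cons, CliffordAlgebra.contractLeft_ι_mul, h a (by simp),
      ih (fun j hj => h j (by simp [hj]))]
    simp

theorem equivExterior_prod {n : ℕ} (l : List (Fin n)) (h : l.Nodup) :
    CliffordAlgebra.equivExterior (negSq n) ((l.map imUnit).prod) =
      (l.map fun j => ExteriorAlgebra.ι ℝ (Pi.single j 1 : Fin n → ℝ)).prod := by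
  induction l with
  | nil => exact CliffordAlgebra.changeForm_one CliffordAlgebra.changeForm.associated_neg_proof
  | cons a t ih =>
    rw [List.nodup_cons] at h
    have ih' := ih h.2
    rw [List.map_cons, List.prod_cons, List.map_cons, List.prod_cons]
    refine (CliffordAlgebra.changeForm_ι_mul CliffordAlgebra.changeForm.associated_neg_proof _ _).trans
      ?_
    have e : CliffordAlgebra.changeForm CliffordAlgebra.changeForm.associated_neg_proof
        ((t.map imUnit).prod) = (t.map fun j => CliffordAlgebra.ι
          (0 : QuadraticForm ℝ (Fin n → ℝ)) (Pi.single j 1)).prod := ih'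
    rw [e, contractLeft_prod_eq_zero, sub_zero]
    · intro j hj
      exact associated_neg_negSq_single a j (fun hh => h.1 (hh ▸ hj))

theorem equivExterior_blade {n : ℕ} (A : Finset (Fin n)) :
    CliffordAlgebra.equivExterior (negSq n) (blade A) =
      (Pi.basisFun ℝ (Fin n)).ExteriorAlgebra A := by
  rw [blade, equivExterior_prod _ (Finset.sort_nodup _ _), ExteriorAlgebra.basis_apply]
  refine Eq.trans ?_ (ExteriorAlgebra.ιMulti_apply (R := ℝ) _).symm
  congr 1
  apply List.ext_getElem
  · simp
  · intro k h1 h2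
    simp
    rfl

/-- The blades `e_A`, `A ⊆ {1, …, n}`, form a basis of `ℝ_{0,n}`; see `bladeBasis_apply`. -/
noncomputable def bladeBasis (n : ℕ) : Module.Basis (Finset (Fin n)) ℝ (Cl n) :=
  (Pi.basisFun ℝ (Fin n)).ExteriorAlgebra.map (CliffordAlgebra.equivExterior (negSq n)).symm

theorem bladeBasis_apply {n : ℕ} (A : Finset (Fin n)) : bladeBasis n A = blade A := by
  rw [bladeBasis, Module.Basis.map_apply, LinearEquiv.symm_apply_eq, equivExterior_blade]

/-- The coordinates `(a_A)_A` of `a = ∑_A a_A e_A`, as a vector of the Euclidean space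
`ℝ^{2ⁿ}`. -/
noncomputable def coords (n : ℕ) : Cl n ≃ₗ[ℝ] EuclideanSpace ℝ (Finset (Fin n)) :=
  (bladeBasis n).equivFun.trans (WithLp.linearEquiv 2 ℝ (Finset (Fin n) → ℝ)).symm

/-- The norm `|a| = (∑_A a_A²)^{1/2}` of `ℝ_{0,n}`; see `norm_def`. -/
noncomputable instance instNormedAddCommGroupCl (n : ℕ) : NormedAddCommGroup (Cl n) :=
  NormedAddCommGroup.induced (Cl n) (EuclideanSpace ℝ (Finset (Fin n))) (coords n)
    (coords n).injective

noncomputable instance instNormedSpaceCl (n : ℕ) : NormedSpace ℝ (Cl n) :=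
  NormedSpace.induced ℝ (Cl n) (EuclideanSpace ℝ (Finset (Fin n))) (coords n)

theorem norm_def {n : ℕ} (a : Cl n) :
    ‖a‖ = Real.sqrt (∑ A : Finset (Fin n), ((bladeBasis n).repr a A) ^ 2) := by
  change ‖coords n a‖ = _
  rw [EuclideanSpace.norm_eq]
  simp [coords]

/-- The identification of `x = (x₀, …, xₙ) ∈ ℝ^{n+1}` with the paravector
`x₀ + ∑_{i=1}^n xᵢ eᵢ ∈ ℝ_{0,n}`. -/
noncomputable def paravector {n : ℕ} (x : EuclideanSpace ℝ (Fin (n + 1))) : Cl n :=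
  algebraMap ℝ (Cl n) (x 0) + ∑ i : Fin n, x i.succ • imUnit i

/-- The Euclidean norm `|∇f(a)| = (∑_{i=0}^n |∂f/∂xᵢ(a)|²)^{1/2}` of the gradient. -/
noncomputable def gradNorm {n : ℕ} (f : EuclideanSpace ℝ (Fin (n + 1)) → Cl n)
    (a : EuclideanSpace ℝ (Fin (n + 1))) : ℝ :=
  Real.sqrt (∑ i : Fin (n + 1), ‖fderiv ℝ f a (EuclideanSpace.single i 1)‖ ^ 2)

end CliffordHarmonic

/-! Let N = n + 1 be the dimension and C = 1 / (2^(1/N) - 1). For N ≥ 2 everything is moved to the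
case a = 0 by a Kelvin transform. With c = a/|a|², inversion in the sphere about c orthogonal to the
unit sphere preserves the ball and exchanges 0 and a. Hence G(y) = |y - c|^(2-N) f(y*) is harmonic,
vanishes at 0, and is bounded by M = (1/|a| - 1)^(2-N). Since |1 - āx| = |a| |x - c|, a bound |G(y)|
≤ C M |y| turns into exactly the claimed bound for f.

The bound at the origin (`norm_le_mul_norm_of_harmonicOnNhd_ball`) needs no Poisson kernel. The
points 0 and y are antipodal about y/2, so after rescaling it suffices to estimate g(te) - g(-te)
for a scalar harmonic g. The difference of g and its mirror image vanishes on the hyperplane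
orthogonal to e, and on the half ball it is dominated by an explicit quadratic superharmonic
barrier. The resulting slope is at most N + 0.35, which is at most C by a binomial estimate.

For the gradient, integrating F against kern(x)⟨u, x⟩ recovers DF(0)u. Testing F against its own
linear part DF(0)x then gives ∑|∂ᵢF(0)|² ≤ (N + 3) M², and N + 3 ≤ C². The Kelvin transform carries
this to a, because f(a) = 0 removes the derivative of the conformal factor and the inversion has a
multiple of a reflection as its derivative at 0.

For n = 0 a harmonic function is affine, C = 1, and the bounds follow by approaching the endpoint
farthest from a. -/

namespace HarmonicBall

open InnerProductSpace Laplacian Filter Topology Metric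
open scoped RealInnerProductSpace

set_option linter.unusedSectionVars false

/-! ### Laplacians from second derivatives along lines -/

section LineDerivatives

variable {E : Type*} [NormedAddCommGroup E] [InnerProductSpace ℝ E]
  {W : Type*} [NormedAddCommGroup W] [NormedSpace ℝ W]

/-- The second derivative `D²f(x)(v, v)`. -/
noncomputable def secondDeriv (f : E → W) (x v : E) : W := fderiv ℝ (fderiv ℝ f) x v v

theorem laplacian_eq_sum_secondDeriv [FiniteDimensional ℝ E] {ι : Type*} [Fintype ι]
    (b : OrthonormalBasis ι ℝ E) (f : E → W) (x : E) :
    Δ f x = ∑ i, secondDeriv f x (b i) := by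
  rw [laplacian_eq_iteratedFDeriv_orthonormalBasis f b]
  simp [iteratedFDeriv_two_apply, secondDeriv]

theorem harmonicOnNhd_of_isOpen [FiniteDimensional ℝ E] {f : E → W} {U : Set E} (hU : IsOpen U)
    (hf : ∀ x ∈ U, ContDiffAt ℝ 2 f x) (hΔ : ∀ x ∈ U, Δ f x = 0) : HarmonicOnNhd f U :=
  fun x hx => ⟨hf x hx, by filter_upwards [hU.mem_nhds hx] with y hy using hΔ y hy⟩

theorem eventually_differentiableAt {f : E → W} {x : E} (hf : ContDiffAt ℝ 2 f x) :
    ∀ᶠ y in 𝓝 x, DifferentiableAt ℝ f y := by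
  filter_upwards [hf.eventually (by simp)] with y hy
  exact hy.differentiableAt (by norm_num)

theorem differentiableAt_fderiv {f : E → W} {x : E} (hf : ContDiffAt ℝ 2 f x) :
    DifferentiableAt ℝ (fderiv ℝ f) x :=
  (hf.fderiv_right (m := 1) (by norm_num)).differentiableAt (by norm_num)

/-- The second-order chain rule: the curve's acceleration contributes the extra first-order term.
For inversions this term cannot be dropped. -/
theorem hasDerivAt_comp_curve {f : E → W} {γ γ₁ : ℝ → E} {γ₂ : E}
    (hf : ContDiffAt ℝ 2 f (γ 0)) (hγ : ∀ᶠ t in 𝓝 0, HasDerivAt γ (γ₁ t) t)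
    (hγ₁ : HasDerivAt γ₁ γ₂ 0) :
    (∀ᶠ t in 𝓝 (0 : ℝ), HasDerivAt (fun t => f (γ t)) (fderiv ℝ f (γ t) (γ₁ t)) t) ∧
      HasDerivAt (fun t => fderiv ℝ f (γ t) (γ₁ t))
        (secondDeriv f (γ 0) (γ₁ 0) + fderiv ℝ f (γ 0) γ₂) 0 := by
  have h0 : HasDerivAt γ (γ₁ 0) 0 := hγ.self_of_nhds
  constructor
  · filter_upwards [hγ, h0.continuousAt.eventually (eventually_differentiableAt hf)] with t ht hft
    exact hft.hasFDerivAt.comp_hasDerivAt t ht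
  · have h1 := (differentiableAt_fderiv hf).hasFDerivAt.comp_hasDerivAt 0 h0
    exact h1.clm_apply hγ₁

theorem hasDerivAt_line (x v : E) (t : ℝ) : HasDerivAt (fun t : ℝ => x + t • v) v t := by
  simpa using ((hasDerivAt_id t).smul_const v).const_add x

theorem secondDeriv_eq_of_hasDerivAt {f : E → W} {x v : E} {g₁ : ℝ → W} {g₂ : W}
    (hf : ContDiffAt ℝ 2 f x)
    (h₁ : ∀ᶠ t in 𝓝 (0 : ℝ), HasDerivAt (fun t : ℝ => f (x + t • v)) (g₁ t) t)
    (h₂ : HasDerivAt g₁ g₂ 0) : secondDeriv f x v = g₂ := by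
  have hc := hasDerivAt_comp_curve (f := f) (γ := fun t : ℝ => x + t • v) (γ₁ := fun _ => v)
    (γ₂ := 0) (by simpa using hf) (Eventually.of_forall fun t => hasDerivAt_line x v t)
    (hasDerivAt_const _ _)
  have he : g₁ =ᶠ[𝓝 0] fun t : ℝ => fderiv ℝ f (x + t • v) v := by
    filter_upwards [h₁, hc.1] with t ht ht'
    exact ht.unique ht'
  have := (h₂.congr_of_eventuallyEq he.symm).unique hc.2
  simpa using this.symm

theorem secondDeriv_smul_comp {G : E → W} {V : Type*} [NormedAddCommGroup V]
    [InnerProductSpace ℝ V] {f : V → W} {x v : E} {h h₁ : ℝ → ℝ}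
    {h₂ : ℝ} {γ γ₁ : ℝ → V} {γ₂ : V} (hG : ContDiffAt ℝ 2 G x)
    (hGe : ∀ᶠ t in 𝓝 (0 : ℝ), G (x + t • v) = h t • f (γ t)) (hf : ContDiffAt ℝ 2 f (γ 0))
    (hh : ∀ᶠ t in 𝓝 0, HasDerivAt h (h₁ t) t) (hh₁ : HasDerivAt h₁ h₂ 0)
    (hγ : ∀ᶠ t in 𝓝 0, HasDerivAt γ (γ₁ t) t) (hγ₁ : HasDerivAt γ₁ γ₂ 0) :
    secondDeriv G x v = h₂ • f (γ 0) + (2 * h₁ 0) • fderiv ℝ f (γ 0) (γ₁ 0) +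
      h 0 • (secondDeriv f (γ 0) (γ₁ 0) + fderiv ℝ f (γ 0) γ₂) := by
  obtain ⟨c₁, c₂⟩ := hasDerivAt_comp_curve hf hγ hγ₁
  refine (secondDeriv_eq_of_hasDerivAt (g₁ := fun t => h₁ t • f (γ t) +
    h t • fderiv ℝ f (γ t) (γ₁ t)) hG ?_
    ((hh₁.smul c₁.self_of_nhds).add (hh.self_of_nhds.smul c₂))).trans ?_
  · filter_upwards [hh, c₁, hGe.eventually_nhds] with t ht ht' he
    refine HasDerivAt.congr_of_eventuallyEq ?_ he
    exact (ht.smul ht').congr_deriv (add_comm _ _)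
  · module

theorem secondDeriv_smul_right (f : E → W) (x v : E) (r : ℝ) :
    secondDeriv f x (r • v) = r ^ 2 • secondDeriv f x v := by
  simp [secondDeriv, smul_smul, pow_two]

/-- An isometry carries an orthonormal basis to another one, and the Laplacian can be computed in
either; the dilation only contributes a factor `r ^ 2`. -/
theorem harmonicOnNhd_comp_similarity [FiniteDimensional ℝ E] {f : E → W} {U V : Set E}
    (hU : IsOpen U) (c : E) (r : ℝ) (L : E ≃ₗᵢ[ℝ] E) (hf : HarmonicOnNhd f V)
    (hUV : ∀ x ∈ U, c + r • L x ∈ V) : HarmonicOnNhd (fun x => f (c + r • L x)) U := by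
  have hC : ∀ x ∈ U, ContDiffAt ℝ 2 (fun x => f (c + r • L x)) x := fun x hx =>
    ContDiffAt.comp x (hf _ (hUV x hx)).1
      (contDiffAt_const.add (contDiffAt_const.smul L.contDiff.contDiffAt))
  refine harmonicOnNhd_of_isOpen hU hC fun x hx => ?_
  set b := stdOrthonormalBasis ℝ E
  rw [laplacian_eq_sum_secondDeriv b]
  have h2 : ∀ i, secondDeriv (fun x => f (c + r • L x)) x (b i) =
      r ^ 2 • secondDeriv f (c + r • L x) (b.map L i) := by
    intro i
    rw [secondDeriv_smul_comp (f := f) (h := fun _ => 1) (h₁ := fun _ => 0) (h₂ := 0)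
      (γ := fun t : ℝ => (c + r • L x) + t • (r • L (b i))) (γ₁ := fun _ => r • L (b i)) (γ₂ := 0)
      (hC x hx) (Eventually.of_forall fun t => ?_) ?_
      (Eventually.of_forall fun t => hasDerivAt_const _ _)
      (hasDerivAt_const _ _) (Eventually.of_forall fun t => hasDerivAt_line _ _ t)
      (hasDerivAt_const _ _)]
    · simp [secondDeriv_smul_right]
    · simpa using (hf _ (hUV x hx)).1
    · simp only [map_add, map_smul, one_smul]
      congr 1
      module
  rw [Finset.sum_congr rfl fun i _ => h2 i, ← Finset.smul_sum,
    ← laplacian_eq_sum_secondDeriv, (hf _ (hUV x hx)).2.self_of_nhds]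
  simp

end LineDerivatives

/-! ### The Kelvin transform preserves harmonicity -/

section Kelvin

open EuclideanGeometry

variable {E : Type*} [NormedAddCommGroup E] [InnerProductSpace ℝ E]
  {W : Type*} [NormedAddCommGroup W] [NormedSpace ℝ W]

theorem reflection_orthogonal_span_singleton (z v : E) :
    (ℝ ∙ z)ᗮ.reflection v = v - (2 * ⟪z, v⟫ / ‖z‖ ^ 2) • z := by
  rw [Submodule.reflection_orthogonal_apply, Submodule.reflection_singleton_apply]
  simp only [RCLike.ofReal_real_eq_id, id_eq, two_smul]
  module

theorem hasDerivAt_normSq_line (z v : E) (t : ℝ) :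
    HasDerivAt (fun t : ℝ => ‖z + t • v‖ ^ 2) (2 * ⟪z, v⟫ + 2 * t * ‖v‖ ^ 2) t := by
  refine (hasDerivAt_line z v t).norm_sq.congr_deriv ?_
  rw [inner_add_left, real_inner_smul_left, real_inner_self_eq_norm_sq]
  ring

/-- The terms are grouped by the order of the derivative of `f`, so that each group can be summed
over an orthonormal basis separately. -/
theorem secondDeriv_kelvin {f : E → W} {c y v : E} {ρ m : ℝ} (hy : y ≠ c) (hv : ‖v‖ = 1)
    (hf : ContDiffAt ℝ 2 f (inversion c ρ y))
    (hG : ContDiffAt ℝ 2 (fun y => (‖y - c‖ ^ 2) ^ m • f (inversion c ρ y)) y) :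
    secondDeriv (fun y => (‖y - c‖ ^ 2) ^ m • f (inversion c ρ y)) y v =
      (4 * m * (m - 1) * (‖y - c‖ ^ 2) ^ m / (‖y - c‖ ^ 2) ^ 2 * ⟪y - c, v⟫ ^ 2 +
        2 * m * (‖y - c‖ ^ 2) ^ m / ‖y - c‖ ^ 2) • f (inversion c ρ y) +
      fderiv ℝ f (inversion c ρ y) (
        (4 * m * (‖y - c‖ ^ 2) ^ m / ‖y - c‖ ^ 2 * ⟪y - c, v⟫) •
          (-(2 * ρ ^ 2 / (‖y - c‖ ^ 2) ^ 2 * ⟪y - c, v⟫) • (y - c) + (ρ ^ 2 / ‖y - c‖ ^ 2) • v) +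
        (‖y - c‖ ^ 2) ^ m • ((ρ ^ 2 * (8 / (‖y - c‖ ^ 2) ^ 3 * ⟪y - c, v⟫ ^ 2 -
          2 / (‖y - c‖ ^ 2) ^ 2)) • (y - c) -
          (4 * ρ ^ 2 / (‖y - c‖ ^ 2) ^ 2 * ⟪y - c, v⟫) • v)) +
      ((‖y - c‖ ^ 2) ^ m * (ρ ^ 2 / ‖y - c‖ ^ 2) ^ 2) •
        secondDeriv f (inversion c ρ y) ((ℝ ∙ (y - c))ᗮ.reflection v) := by
  set z := y - c with hz
  have hz0 : z ≠ 0 := sub_ne_zero.2 hy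
  have hQ : 0 < ‖z‖ ^ 2 := by positivity
  set q : ℝ → ℝ := fun t => ‖z + t • v‖ ^ 2 with hq
  have hq0 : q 0 = ‖z‖ ^ 2 := by simp [hq]
  have hqd : ∀ t, HasDerivAt q (2 * ⟪z, v⟫ + 2 * t) t := fun t => by
    simpa [hv] using hasDerivAt_normSq_line z v t
  have hqd' : HasDerivAt (fun t : ℝ => 2 * ⟪z, v⟫ + 2 * t) 2 0 := by
    simpa using ((hasDerivAt_id (0 : ℝ)).const_mul 2).const_add (2 * ⟪z, v⟫)
  have hqpos : ∀ᶠ t in 𝓝 0, 0 < q t :=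
    (hqd 0).continuousAt.eventually (lt_mem_nhds (by rw [hq0]; exact hQ))
  have hinv : ∀ x, inversion c ρ x = c + (ρ ^ 2 * (‖x - c‖ ^ 2)⁻¹) • (x - c) := by
    intro x
    rw [inversion, dist_eq_norm, vsub_eq_sub, vadd_eq_add, add_comm, div_pow, div_eq_mul_inv]
  have hγ0 : c + (ρ ^ 2 * (q 0)⁻¹) • (z + (0 : ℝ) • v) = inversion c ρ y := by
    rw [hinv, hq0, zero_smul, add_zero]
  have hpm2 : (‖z‖ ^ 2) ^ (m - 1 - 1) = (‖z‖ ^ 2) ^ m / (‖z‖ ^ 2) ^ 2 := by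
    rw [Real.rpow_sub_one hQ.ne', Real.rpow_sub_one hQ.ne']; field_simp
  have hpm1 : (‖z‖ ^ 2) ^ (m - 1) = (‖z‖ ^ 2) ^ m / ‖z‖ ^ 2 := by
    rw [Real.rpow_sub_one hQ.ne']
  rw [secondDeriv_smul_comp (f := f) (h := fun t => q t ^ m)
    (h₁ := fun t => (2 * ⟪z, v⟫ + 2 * t) * m * q t ^ (m - 1))
    (h₂ := 2 * m * q 0 ^ (m - 1) +
      2 * ⟪z, v⟫ * m * (2 * ⟪z, v⟫ * (m - 1) * q 0 ^ (m - 1 - 1)))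
    (γ := fun t => c + (ρ ^ 2 * (q t)⁻¹) • (z + t • v))
    (γ₁ := fun t => (ρ ^ 2 * (q t)⁻¹) • v +
      (ρ ^ 2 * (-(2 * ⟪z, v⟫ + 2 * t) / q t ^ 2)) • (z + t • v))
    (γ₂ := (ρ ^ 2 * (-(2 * ⟪z, v⟫) / q 0 ^ 2)) • v + ((ρ ^ 2 * (-(2 * ⟪z, v⟫) / q 0 ^ 2)) • v +
      (ρ ^ 2 * (8 / q 0 ^ 3 * ⟪z, v⟫ ^ 2 - 2 / q 0 ^ 2)) • (z + (0 : ℝ) • v)))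
    hG _ _ _ _ _ _]
  · rw [hγ0]
    -- Inversion is conformal: its derivative is a scalar times the reflection in the hyperplane
    -- orthogonal to `y - c`.
    have e1 : (ρ ^ 2 * (q 0)⁻¹) • v + (ρ ^ 2 * (-(2 * ⟪z, v⟫ + 2 * 0) / q 0 ^ 2)) •
        (z + (0 : ℝ) • v) = (ρ ^ 2 / ‖z‖ ^ 2) • (ℝ ∙ z)ᗮ.reflection v := by
      rw [reflection_orthogonal_span_singleton, hq0, smul_sub, smul_smul, zero_smul, add_zero,
        sub_eq_add_neg, ← neg_smul]
      congr 2
      field_simp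
      ring
    rw [e1, secondDeriv_smul_right, ← e1]
    simp only [hq0, hpm1, hpm2, zero_smul, add_zero, mul_zero, map_add, map_smul, map_sub,
      neg_smul, map_neg]
    match_scalars <;> field_simp <;> ring
  · refine Eventually.of_forall fun t => ?_
    have : y + t • v - c = z + t • v := by rw [hz]; abel
    simp only [hinv, this, hq]
  · simpa only [hγ0] using hf
  · filter_upwards [hqpos] with t ht
    exact (hqd t).rpow_const (Or.inl ht.ne')
  · have := (hqd'.mul_const m).mul ((hqd 0).rpow_const (p := m - 1) (Or.inl (hq0 ▸ hQ.ne')))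
    refine this.congr_deriv ?_
    ring
  · filter_upwards [hqpos] with t ht
    have := ((((hqd t).inv ht.ne').const_mul (ρ ^ 2)).smul (hasDerivAt_line z v t)).const_add c
    exact this
  · have hne : q 0 ≠ 0 := hq0 ▸ hQ.ne'
    have h1 := (((hqd 0).inv hne).const_mul (ρ ^ 2)).smul_const v
    have h2 := ((hqd'.neg.div ((hqd 0).pow 2) (pow_ne_zero 2 hne)).const_mul (ρ ^ 2)).smul
      (hasDerivAt_line z v 0)
    refine (h1.add h2).congr_deriv ?_
    simp only [mul_zero, add_zero, Pi.div_apply, Pi.neg_apply, Pi.pow_apply]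
    match_scalars <;> field_simp <;> ring

/-- Summed over a basis, the zeroth- and first-order groups both cancel precisely because `2 * m = 2
- N`; the second-order group is a multiple of the Laplacian of `f` in the reflected basis. -/
theorem harmonicOnNhd_kelvin [FiniteDimensional ℝ E] {f : E → W} {U V : Set E} (hU : IsOpen U)
    {c : E} {ρ m : ℝ} (hm : 2 * m = 2 - Module.finrank ℝ E) (hf : HarmonicOnNhd f V)
    (hc : c ∉ U) (hUV : ∀ y ∈ U, inversion c ρ y ∈ V) :
    HarmonicOnNhd (fun y => (‖y - c‖ ^ 2) ^ m • f (inversion c ρ y)) U := by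
  have hne : ∀ y ∈ U, y ≠ c := fun y hy h => hc (h ▸ hy)
  have hC : ∀ y ∈ U, ContDiffAt ℝ 2 (fun y => (‖y - c‖ ^ 2) ^ m • f (inversion c ρ y)) y := by
    intro y hy
    have h1 : ContDiffAt ℝ 2 (fun y => ‖y - c‖ ^ 2) y :=
      (contDiffAt_id.sub contDiffAt_const).norm_sq ℝ
    have h2 : ContDiffAt ℝ 2 (fun y => inversion c ρ y) y :=
      contDiffAt_const.inversion contDiffAt_const contDiffAt_id (hne y hy)
    refine (h1.rpow_const_of_ne ?_).smul ((hf _ (hUV y hy)).1.comp y h2)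
    have := sub_ne_zero.2 (hne y hy)
    positivity
  refine harmonicOnNhd_of_isOpen hU hC fun y hy => ?_
  set b := stdOrthonormalBasis ℝ E
  have hz0 : y - c ≠ 0 := sub_ne_zero.2 (hne y hy)
  rw [laplacian_eq_sum_secondDeriv b, Finset.sum_congr rfl fun i _ => secondDeriv_kelvin
    (hne y hy) (b.orthonormal.1 i) (hf _ (hUV y hy)).1 (hC y hy), Finset.sum_add_distrib,
    Finset.sum_add_distrib, ← Finset.sum_smul, ← map_sum, ← Finset.smul_sum]
  have e1 := laplacian_eq_sum_secondDeriv (b.map (ℝ ∙ (y - c))ᗮ.reflection) f (inversion c ρ y)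
  rw [(hf _ (hUV y hy)).2.self_of_nhds] at e1
  simp only [OrthonormalBasis.map_apply, Pi.zero_apply] at e1
  rw [← e1]
  set z := y - c
  clear_value z
  set Q := ‖z‖ ^ 2 with hQdef
  have hQ : Q ≠ 0 := by positivity
  have s1 : ∑ i, ⟪z, b i⟫ ^ 2 = Q := b.sum_sq_inner_left z
  have s2 : ∑ i, ⟪z, b i⟫ • b i = z := by
    conv_rhs => rw [← b.sum_repr' z]
    simp only [real_inner_comm]
  have e2 : ∑ i, (4 * m * (m - 1) * Q ^ m / Q ^ 2 * ⟪z, b i⟫ ^ 2 + 2 * m * Q ^ m / Q) = 0 := by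
    rw [Finset.sum_add_distrib, ← Finset.mul_sum, s1]
    simp only [Finset.sum_const, Finset.card_univ, Fintype.card_fin, nsmul_eq_mul]
    field_simp
    linear_combination 2 * m * Q ^ m * hm
  have e3 : ∑ i, ((4 * m * Q ^ m / Q * ⟪z, b i⟫) •
      (-(2 * ρ ^ 2 / Q ^ 2 * ⟪z, b i⟫) • z + (ρ ^ 2 / Q) • b i) +
      Q ^ m • ((ρ ^ 2 * (8 / Q ^ 3 * ⟪z, b i⟫ ^ 2 - 2 / Q ^ 2)) • z -
        (4 * ρ ^ 2 / Q ^ 2 * ⟪z, b i⟫) • b i)) = 0 := by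
    have : ∀ i, ((4 * m * Q ^ m / Q * ⟪z, b i⟫) •
      (-(2 * ρ ^ 2 / Q ^ 2 * ⟪z, b i⟫) • z + (ρ ^ 2 / Q) • b i) +
      Q ^ m • ((ρ ^ 2 * (8 / Q ^ 3 * ⟪z, b i⟫ ^ 2 - 2 / Q ^ 2)) • z -
        (4 * ρ ^ 2 / Q ^ 2 * ⟪z, b i⟫) • b i)) =
      (Q ^ m * ρ ^ 2 / Q ^ 3 * (8 - 8 * m)) • ⟪z, b i⟫ ^ 2 • z
        - (2 * Q ^ m * ρ ^ 2 / Q ^ 2) • z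
        + (Q ^ m * ρ ^ 2 / Q ^ 2 * (4 * m - 4)) • ⟪z, b i⟫ • b i := by
      intro i
      match_scalars <;> field_simp <;> ring
    rw [Finset.sum_congr rfl fun i _ => this i, Finset.sum_add_distrib, Finset.sum_sub_distrib,
      ← Finset.smul_sum, ← Finset.smul_sum, ← Finset.smul_sum, s2, ← Finset.sum_smul, s1]
    simp only [Finset.sum_const, Finset.card_univ, Fintype.card_fin]
    rw [← Nat.cast_smul_eq_nsmul ℝ]
    match_scalars
    field_simp
    linear_combination -2 * Q ^ m * ρ ^ 2 * hm
  rw [e2, e3]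
  simp

end Kelvin

/-! ### Barrier comparison and the Schwarz lemma at the origin -/

section MaximumPrinciple

variable {E : Type*} [NormedAddCommGroup E] [InnerProductSpace ℝ E]

theorem secondDeriv_nonpos_of_isLocalMax {g : E → ℝ} {x : E} (v : E) (hg : ContDiffAt ℝ 2 g x)
    (hx : IsLocalMax g x) : secondDeriv g x v ≤ 0 := by
  obtain ⟨h1, h2⟩ := hasDerivAt_comp_curve (f := g) (γ := fun t : ℝ => x + t • v)
    (γ₁ := fun _ => v) (γ₂ := 0) (by simpa using hg)
    (Eventually.of_forall fun t => hasDerivAt_line x v t) (hasDerivAt_const _ _)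
  simp only [map_zero, add_zero, zero_smul] at h2
  set φ : ℝ → ℝ := fun t => g (x + t • v)
  by_contra! hpos
  have hmax : IsLocalMax φ 0 := by
    have hc : Tendsto (fun t : ℝ => x + t • v) (𝓝 0) (𝓝 x) := by
      simpa using (hasDerivAt_line x v 0).continuousAt.tendsto
    have := hc.eventually hx
    simpa [φ, IsLocalMax, IsMaxFilter] using this
  have hd : deriv φ =ᶠ[𝓝 0] fun t => fderiv ℝ g (x + t • v) v := by
    filter_upwards [h1] with t ht using ht.deriv
  have hdd : deriv (deriv φ) 0 = secondDeriv g x v := by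
    rw [hd.deriv_eq, h2.deriv]
  -- A positive second derivative makes 0 a local minimum as well, so φ is locally constant and its
  -- second derivative is 0, a contradiction.
  have hmin : IsLocalMin φ 0 := isLocalMin_of_deriv_deriv_pos (hdd ▸ hpos) hmax.deriv_eq_zero
    h1.self_of_nhds.continuousAt
  have hconst : φ =ᶠ[𝓝 0] fun _ => φ 0 := by
    filter_upwards [hmin, hmax] with t h h' using le_antisymm h' h
  have h0 : deriv φ =ᶠ[𝓝 0] fun _ => 0 := by
    filter_upwards [hconst.eventuallyEq_nhds] with t ht
    rw [ht.deriv_eq, deriv_const]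
  rw [h0.deriv_eq, deriv_const] at hdd
  exact hpos.ne hdd

theorem laplacian_nonpos_of_isLocalMax [FiniteDimensional ℝ E] {g : E → ℝ} {x : E}
    (hg : ContDiffAt ℝ 2 g x) (hx : IsLocalMax g x) : Δ g x ≤ 0 := by
  rw [laplacian_eq_sum_secondDeriv (stdOrthonormalBasis ℝ E)]
  exact Finset.sum_nonpos fun i _ => secondDeriv_nonpos_of_isLocalMax _ hg hx

/-- The barrier `|x|² / r² + K (t / r) (1 - t / r)` with `t = ⟪e, x⟫`. -/
noncomputable def barrier (e : E) (r K : ℝ) (x : E) : ℝ :=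
  ‖x‖ ^ 2 / r ^ 2 + K * (⟪e, x⟫ / r * (1 - ⟪e, x⟫ / r))

theorem contDiff_barrier (e : E) (r K : ℝ) : ContDiff ℝ 2 (barrier e r K) := by
  have h1 : ContDiff ℝ 2 fun x : E => ‖x‖ ^ 2 := contDiff_norm_sq ℝ
  have h2 : ContDiff ℝ 2 fun x : E => ⟪e, x⟫ := contDiff_const.inner ℝ contDiff_id
  exact (h1.div_const _).add (contDiff_const.mul ((h2.div_const _).mul
    (contDiff_const.sub (h2.div_const _))))

theorem secondDeriv_barrier (e : E) (r K : ℝ) (x v : E) :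
    secondDeriv (barrier e r K) x v = 2 * ‖v‖ ^ 2 / r ^ 2 - 2 * K * ⟪e, v⟫ ^ 2 / r ^ 2 := by
  have hi : ∀ t : ℝ, HasDerivAt (fun t : ℝ => ⟪e, x + t • v⟫ / r) (⟪e, v⟫ / r) t := fun t => by
    have := ((hasDerivAt_const t e).inner ℝ (hasDerivAt_line x v t)).div_const r
    simpa using this
  refine secondDeriv_eq_of_hasDerivAt (g₁ := fun t => (2 * ⟪x, v⟫ + 2 * t * ‖v‖ ^ 2) / r ^ 2 +
    K * (⟪e, v⟫ / r * (1 - ⟪e, x + t • v⟫ / r) + ⟪e, x + t • v⟫ / r * -(⟪e, v⟫ / r)))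
    (contDiff_barrier e r K).contDiffAt (Eventually.of_forall fun t => ?_) ?_
  · exact ((hasDerivAt_normSq_line x v t).div_const _).add
      (((hi t).mul ((hi t).const_sub 1)).const_mul K)
  · have h1 : HasDerivAt (fun t : ℝ => (2 * ⟪x, v⟫ + 2 * t * ‖v‖ ^ 2) / r ^ 2)
        (2 * ‖v‖ ^ 2 / r ^ 2) 0 := by
      have := (((((hasDerivAt_id (0 : ℝ)).const_mul 2).mul_const (‖v‖ ^ 2)).const_add
        (2 * ⟪x, v⟫)).div_const (r ^ 2))
      simpa using this
    refine (h1.add (((((hi 0).const_sub 1).const_mul (⟪e, v⟫ / r)).add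
      ((hi 0).mul_const (-(⟪e, v⟫ / r)))).const_mul K)).congr_deriv ?_
    ring

theorem laplacian_barrier [FiniteDimensional ℝ E] {e : E} (he : ‖e‖ = 1) (r K : ℝ) (x : E) :
    Δ (barrier e r K) x = 2 * (Module.finrank ℝ E - K) / r ^ 2 := by
  set b := stdOrthonormalBasis ℝ E
  rw [laplacian_eq_sum_secondDeriv b]
  simp only [secondDeriv_barrier, b.orthonormal.1]
  rw [Finset.sum_sub_distrib, ← Finset.sum_div, ← Finset.sum_div, ← Finset.mul_sum, ← Finset.mul_sum,
    b.sum_sq_inner_left e, he]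
  simp
  ring

/-- For `K` above the dimension the barrier is strictly superharmonic, so it can be compared with
the harmonic function `g - g ∘ σ` on the half ball. On the flat face that function is 0; on the
sphere of radius `r` it is at most `2 * M`, while the barrier is at least 1. -/
theorem sub_comp_reflection_le_barrier [FiniteDimensional ℝ E] {g : E → ℝ}
    (hg : HarmonicOnNhd g (ball 0 1)) {M : ℝ} (hM : 0 < M) (hb : ∀ x ∈ ball (0 : E) 1, |g x| ≤ M)
    {e : E} (he : ‖e‖ = 1) {r K : ℝ} (hr : 0 < r) (hr1 : r < 1) (hK : Module.finrank ℝ E < K)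
    {x : E} (hx : ‖x‖ ≤ r) (hxe : 0 ≤ ⟪e, x⟫) :
    g x - g ((ℝ ∙ e)ᗮ.reflection x) ≤ 2 * M * barrier e r K x := by
  set σ : E ≃ₗᵢ[ℝ] E := (ℝ ∙ e)ᗮ.reflection
  have hK0 : 0 < K := lt_of_le_of_lt (Nat.cast_nonneg _) hK
  have hσ : HarmonicOnNhd (fun x => g (σ x)) (ball 0 1) := by
    have := harmonicOnNhd_comp_similarity isOpen_ball 0 1 σ hg (U := ball 0 1) (by simp)
    simpa using this
  -- The Laplacian of `u` is strictly positive, so its maximum over the half ball lies on the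
  -- boundary.
  set u : E → ℝ := g - (fun x => g (σ x)) - (2 * M) • barrier e r K with hu
  have huC : ∀ y ∈ ball (0 : E) 1, ContDiffAt ℝ 2 u y := fun y hy =>
    ((hg y hy).1.sub (hσ y hy).1).sub (contDiffAt_const.smul (contDiff_barrier e r K).contDiffAt)
  have huΔ : ∀ y ∈ ball (0 : E) 1, 0 < Δ u y := fun y hy => by
    have hB : ContDiffAt ℝ 2 ((2 * M) • barrier e r K) y :=
      contDiffAt_const.smul (contDiff_barrier e r K).contDiffAt
    have hA : ContDiffAt ℝ 2 (g - fun x => g (σ x)) y := (hg y hy).1.sub (hσ y hy).1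
    rw [hu, hA.laplacian_sub hB,
      (hg y hy).1.laplacian_sub (hσ y hy).1, laplacian_smul _ (contDiff_barrier e r K).contDiffAt,
      (hg y hy).2.self_of_nhds, (hσ y hy).2.self_of_nhds, laplacian_barrier he]
    simp only [Pi.zero_apply, sub_self, zero_sub, smul_eq_mul]
    have : 0 < 2 * M * (2 * (K - Module.finrank ℝ E) / r ^ 2) := by
      have := sub_pos.2 hK
      positivity
    calc 0 < _ := this
      _ = _ := by ring
  set S : Set E := {x | x ∈ closedBall 0 r ∧ 0 ≤ ⟪e, x⟫} with hS
  have hSb : ∀ y ∈ S, y ∈ ball (0 : E) 1 := fun y hy =>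
    closedBall_subset_ball hr1 hy.1
  have hclosed : IsClosed {x : E | 0 ≤ ⟪e, x⟫} :=
    isClosed_le continuous_const (continuous_const.inner continuous_id)
  have hScompact : IsCompact S := (isCompact_closedBall 0 r).inter_right hclosed
  obtain ⟨p, hpS, hp⟩ := hScompact.exists_isMaxOn ⟨x, by simpa [hS] using ⟨hx, hxe⟩⟩
    (fun y hy => (huC y (hSb y hy)).continuousAt.continuousWithinAt)
  have hup : u p ≤ 0 := by
    have hp1 : ‖p‖ ≤ r := by simpa using hpS.1
    have hte : ⟪e, p⟫ ≤ r := (real_inner_le_norm e p).trans (by rw [he, one_mul]; exact hp1)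
    have hbar : 0 ≤ ⟪e, p⟫ / r * (1 - ⟪e, p⟫ / r) := by
      have : ⟪e, p⟫ / r ≤ 1 := (div_le_one hr).2 hte
      exact mul_nonneg (div_nonneg hpS.2 hr.le) (by linarith)
    rcases hpS.2.eq_or_lt with h0 | h0
    · have : σ p = p := by
        simp only [σ]
        rw [reflection_orthogonal_span_singleton, ← h0]
        simp
      simp only [hu, Pi.sub_apply, Pi.smul_apply, smul_eq_mul, this, sub_self, zero_sub, barrier]
      have : 0 ≤ 2 * M * (‖p‖ ^ 2 / r ^ 2 + K * (⟪e, p⟫ / r * (1 - ⟪e, p⟫ / r))) := by positivity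
      linarith
    · rcases hp1.eq_or_lt with h1 | h1
      · have hb1 := abs_le.1 (hb p (hSb p hpS))
        have hb2 := abs_le.1 (hb (σ p) (by simpa using hSb p hpS))
        simp only [hu, Pi.sub_apply, Pi.smul_apply, smul_eq_mul, barrier, h1]
        rw [div_self (by positivity)]
        have : 0 ≤ 2 * M * (K * (⟪e, p⟫ / r * (1 - ⟪e, p⟫ / r))) := by positivity
        linarith
      · have hnhds : S ∈ 𝓝 p := by
          have a1 : ball (0 : E) r ∈ 𝓝 p := isOpen_ball.mem_nhds (by simpa using h1)
          have a2 : {x : E | 0 < ⟪e, x⟫} ∈ 𝓝 p :=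
            (isOpen_lt continuous_const (continuous_const.inner continuous_id)).mem_nhds h0
          filter_upwards [a1, a2] with y h1 h2
          exact ⟨ball_subset_closedBall h1, le_of_lt h2⟩
        exact absurd (laplacian_nonpos_of_isLocalMax (huC p (hSb p hpS)) (hp.isLocalMax hnhds))
          (not_le.2 (huΔ p (hSb p hpS)))
  have := (hp (show x ∈ S by simpa [hS] using ⟨hx, hxe⟩)).trans hup
  simp only [hu, Pi.sub_apply, Pi.smul_apply, smul_eq_mul] at this
  linarith

/-- The previous estimate on the axis, where reflection is negation. Radii `r < 1` are used because
`g` need not extend to the unit sphere; then `r` tends to 1. -/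
theorem sub_neg_le_of_harmonicOnNhd_ball [FiniteDimensional ℝ E] {g : E → ℝ}
    (hg : HarmonicOnNhd g (ball 0 1)) {M : ℝ} (hM : 0 < M) (hb : ∀ x ∈ ball (0 : E) 1, |g x| ≤ M)
    {e : E} (he : ‖e‖ = 1) {K : ℝ} (hK : Module.finrank ℝ E < K) {t : ℝ} (ht : 0 ≤ t)
    (ht1 : t < 1) : g (t • e) - g (-(t • e)) ≤ 2 * M * (t ^ 2 + K * (t * (1 - t))) := by
  have hev : ∀ᶠ r in 𝓝[<] (1 : ℝ), g (t • e) - g (-(t • e)) ≤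
      2 * M * (t ^ 2 / r ^ 2 + K * (t / r * (1 - t / r))) := by
    have hr0 : ∀ᶠ r in 𝓝[<] (1 : ℝ), max t (1 / 2) < r :=
      nhdsWithin_le_nhds (lt_mem_nhds (max_lt ht1 (by norm_num)))
    filter_upwards [hr0, self_mem_nhdsWithin] with r h1 h2
    have h3 : t < r := (le_max_left _ _).trans_lt h1
    have h4 : 0 < r := lt_trans (by norm_num) ((le_max_right t (1 / 2)).trans_lt h1)
    have hee : ⟪e, e⟫ = 1 := by rw [real_inner_self_eq_norm_sq, he]; norm_num
    have := sub_comp_reflection_le_barrier hg hM hb he h4 h2 hK (x := t • e)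
      (by rw [norm_smul, he, mul_one, Real.norm_of_nonneg ht]; exact h3.le)
      (by rw [real_inner_smul_right, hee, mul_one]; exact ht)
    rw [reflection_orthogonal_span_singleton, barrier, real_inner_smul_right, hee, norm_smul, he,
      Real.norm_of_nonneg ht] at this
    have e1 : t • e - (2 * (t * 1) / 1 ^ 2) • e = -(t • e) := by module
    rw [e1] at this
    simpa using this
  refine ge_of_tendsto ?_ hev
  have hc : ContinuousAt (fun r : ℝ => 2 * M * (t ^ 2 / r ^ 2 + K * (t / r * (1 - t / r)))) 1 := by
    fun_prop (disch := norm_num)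
  have := hc.tendsto.mono_left (nhdsWithin_le_nhds (s := Set.Iio (1 : ℝ)))
  simpa using this

variable {W : Type*} [NormedAddCommGroup W] [InnerProductSpace ℝ W]

/-- With `t = r / (2 - r)` the left side behaves like `K * r` near 0; the margin 1/4 in `C` absorbs
the higher-order terms for `r ≤ 1 / C`. -/
theorem barrier_slope_bound {K C r : ℝ} (hK : 2.1 ≤ K) (hC : K + 1 / 4 ≤ C) (hr : 0 ≤ r)
    (hr1 : r * C ≤ 1) :
    2 * ((r / (2 - r)) ^ 2 + K * (r / (2 - r) * (1 - r / (2 - r)))) ≤ C * r := by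
  have hr2 : r < 1 := by nlinarith
  have h2 : 0 < 2 - r := by linarith
  have key : 2 * (2 * K - (2 * K - 1) * r) ≤ C * (2 - r) ^ 2 := by
    have h3 : 0 ≤ (1 - r * C) * (4 * (C - K) + 1 - r * C) :=
      mul_nonneg (by linarith) (by linarith)
    have h4 : 0 ≤ C * (4 * (C - K)) - (4 * (C - K) + 1) := by nlinarith
    -- This expression is exactly the sum of those in `h3` and `h4`.
    have h5 : 0 ≤ C * (C * (2 - r) ^ 2 - 2 * (2 * K - (2 * K - 1) * r)) := by nlinarith
    have := nonneg_of_mul_nonneg_right h5 (by linarith)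
    linarith
  have e : 2 * ((r / (2 - r)) ^ 2 + K * (r / (2 - r) * (1 - r / (2 - r)))) =
      r * (2 * (2 * K - (2 * K - 1) * r)) / (2 - r) ^ 2 := by
    field_simp
    ring
  rw [e, div_le_iff₀ (by positivity)]
  nlinarith [mul_le_mul_of_nonneg_left key hr]

/-- A Schwarz lemma for bounded harmonic functions on the unit ball. -/
theorem norm_le_mul_norm_of_harmonicOnNhd_ball [FiniteDimensional ℝ E] {F : E → W}
    (hF : HarmonicOnNhd F (ball 0 1)) {M C : ℝ} (hb : ∀ x ∈ ball (0 : E) 1, ‖F x‖ ≤ M)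
    (h0 : F 0 = 0) (hN : 2 ≤ Module.finrank ℝ E) (hC : Module.finrank ℝ E + 0.35 ≤ C)
    {y : E} (hy : y ∈ ball (0 : E) 1) : ‖F y‖ ≤ C * M * ‖y‖ := by
  have hN' : (2 : ℝ) ≤ Module.finrank ℝ E := by exact_mod_cast hN
  have hM0 : 0 ≤ M := (norm_nonneg _).trans (hb y hy)
  have hCpos : 0 < C := by linarith
  by_cases hFy : F y = 0
  · rw [hFy, norm_zero]; positivity
  have hM : 0 < M := (norm_pos_iff.2 hFy).trans_le (hb y hy)
  have hy0 : y ≠ 0 := fun h => hFy (h ▸ h0)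
  set r := ‖y‖ with hr
  have hr0 : 0 < r := norm_pos_iff.2 hy0
  have hr1 : r < 1 := by simpa using hy
  -- Once `r * C ≥ 1`, the trivial bound `M` is enough.
  rcases le_total 1 (r * C) with h1 | h1
  · calc ‖F y‖ ≤ M := hb y hy
      _ = 1 * M := (one_mul M).symm
      _ ≤ (r * C) * M := by gcongr
      _ = _ := by ring
  -- Pairing with the direction of `F y` reduces to a scalar function.
  set w : W := ‖F y‖⁻¹ • F y
  have hw : ‖w‖ = 1 := norm_smul_inv_norm (𝕜 := ℝ) hFy
  -- The ball of centre `y / 2` and radius `1 - r / 2` lies in the unit ball. In it 0 and `y` are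
  -- antipodal, at relative distance `r / (2 - r)` from the centre.
  have hmem : ∀ z ∈ ball (0 : E) 1, (1 / 2 : ℝ) • y + (1 - r / 2) • z ∈ ball (0 : E) 1 := by
    intro z hz
    rw [mem_ball_zero_iff] at hz ⊢
    calc _ ≤ ‖(1 / 2 : ℝ) • y‖ + ‖(1 - r / 2) • z‖ := norm_add_le _ _
      _ = r / 2 + (1 - r / 2) * ‖z‖ := by
        rw [norm_smul, norm_smul, Real.norm_of_nonneg (by norm_num),
          Real.norm_of_nonneg (by linarith)]
        ring
      _ < 1 := by nlinarith
  have hG : HarmonicOnNhd (fun z : E => F ((1 / 2 : ℝ) • y + (1 - r / 2) • z)) (ball 0 1) := by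
    simpa using harmonicOnNhd_comp_similarity isOpen_ball ((1 / 2 : ℝ) • y) (1 - r / 2)
      (LinearIsometryEquiv.refl ℝ E) hF (by simpa using hmem)
  have hg : HarmonicOnNhd (fun z : E => ⟪w, F ((1 / 2 : ℝ) • y + (1 - r / 2) • z)⟫)
      (ball 0 1) := hG.comp_CLM (innerSL ℝ w)
  have hgb : ∀ z ∈ ball (0 : E) 1, |⟪w, F ((1 / 2 : ℝ) • y + (1 - r / 2) • z)⟫| ≤ M := by
    intro z hz
    refine (abs_real_inner_le_norm _ _).trans ?_
    rw [hw, one_mul]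
    exact hb _ (hmem z hz)
  have h2 : 0 < 2 - r := by linarith
  have ht : 0 ≤ r / (2 - r) := by positivity
  have ht1 : r / (2 - r) < 1 := by rw [div_lt_one h2]; linarith
  -- The excess 0.1 makes the barrier strict; with the margin 1/4 of `barrier_slope_bound` it
  -- accounts for the 0.35.
  have := sub_neg_le_of_harmonicOnNhd_ball hg hM hgb (norm_smul_inv_norm (𝕜 := ℝ) hy0)
    (K := Module.finrank ℝ E + 0.1) (by linarith) ht ht1
  have ez : (1 - r / 2) • (r / (2 - r)) • r⁻¹ • y = (1 / 2 : ℝ) • y := by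
    rw [smul_smul, smul_smul]
    congr 1
    field_simp
  simp only [RCLike.ofReal_real_eq_id, id_eq, smul_neg, ez, add_neg_cancel, h0,
    inner_zero_right, sub_zero, ← add_smul, ← hr] at this
  norm_num only [one_smul] at this
  have e3 : ⟪w, F y⟫ = ‖F y‖ := by
    rw [real_inner_smul_left, real_inner_self_eq_norm_sq]
    field_simp
  rw [e3] at this
  have hs := barrier_slope_bound (K := Module.finrank ℝ E + 0.1) (C := C) (r := r) (by linarith)
    (by norm_num at hC ⊢; linarith) hr0.le h1
  have := mul_le_mul_of_nonneg_left hs hM.le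
  norm_num only at this ⊢
  nlinarith

end MaximumPrinciple

/-! ### Weighted integrals of harmonic functions over the ball -/

section Weight

open MeasureTheory


variable {E : Type*} [NormedAddCommGroup E] [InnerProductSpace ℝ E]
  {W : Type*} [NormedAddCommGroup W] [NormedSpace ℝ W]

theorem sum_inner_smul_apply {ι : Type*} [Fintype ι] (b : OrthonormalBasis ι ℝ E) (L : E →L[ℝ] W)
    (x : E) : ∑ i, ⟪b i, x⟫ • L (b i) = L x := by
  conv_rhs => rw [← b.sum_repr' x]
  simp

/-- The weight `(1 - |x|²)^{3/2}` on the unit ball, extended by zero. -/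
noncomputable def weight (x : E) : ℝ := (1 - ‖x‖ ^ 2) * √(1 - ‖x‖ ^ 2)

/-- The weight `3 (1 - |x|²)^{1/2}` on the unit ball, extended by zero. -/
noncomputable def kern (x : E) : ℝ := 3 * √(1 - ‖x‖ ^ 2)

theorem kern_nonneg (x : E) : 0 ≤ kern x := by unfold kern; positivity

theorem continuous_kern : Continuous (kern : E → ℝ) := by unfold kern; fun_prop

theorem sqrt_eq_zero_of_notMem {x : E} (hx : x ∉ closedBall (0 : E) 1) :
    √(1 - ‖x‖ ^ 2) = 0 := by
  apply Real.sqrt_eq_zero_of_nonpos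
  have : 1 < ‖x‖ := by simpa using hx
  nlinarith

theorem weight_eq_zero {x : E} (hx : x ∉ closedBall (0 : E) 1) : weight x = 0 := by
  rw [weight, sqrt_eq_zero_of_notMem hx, mul_zero]

theorem kern_eq_zero {x : E} (hx : x ∉ closedBall (0 : E) 1) : kern x = 0 := by
  rw [kern, sqrt_eq_zero_of_notMem hx, mul_zero]

/-- Since `√s = 0` for `s ≤ 0`, the formula persists across 0. This makes the extended weight C¹ on
the whole space. -/
theorem hasDerivAt_mul_sqrt (s : ℝ) : HasDerivAt (fun s : ℝ => s * √s) (3 / 2 * √s) s := by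
  rcases lt_trichotomy s 0 with h | rfl | h
  · rw [Real.sqrt_eq_zero_of_nonpos h.le, mul_zero]
    refine (hasDerivAt_const s (0 : ℝ)).congr_of_eventuallyEq ?_
    filter_upwards [gt_mem_nhds h] with t ht
    rw [Real.sqrt_eq_zero_of_nonpos (le_of_lt ht), mul_zero]
  · rw [Real.sqrt_zero, mul_zero, hasDerivAt_iff_tendsto_slope_zero]
    have h1 : Tendsto (fun t : ℝ => √t) (𝓝[≠] 0) (𝓝 0) := by
      have := (Real.continuous_sqrt.tendsto 0).mono_left (nhdsWithin_le_nhds (s := {0}ᶜ))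
      simpa using this
    refine h1.congr' ?_
    filter_upwards [self_mem_nhdsWithin] with t ht
    have : t ≠ 0 := ht
    simp
    field_simp
  · refine ((hasDerivAt_id s).mul (Real.hasDerivAt_sqrt h.ne')).congr_deriv ?_
    have h2 : 0 < √s := Real.sqrt_pos.2 h
    have h3 : √s ^ 2 = s := Real.sq_sqrt h.le
    simp only [id]
    field_simp
    rw [h3]
    ring

theorem hasFDerivAt_weight (x : E) : HasFDerivAt weight (-(kern x) • innerSL ℝ x) x := by
  have h1 : HasFDerivAt (fun x : E => 1 - ‖x‖ ^ 2) (-(2 • innerSL ℝ x)) x :=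
    ((hasStrictFDerivAt_norm_sq x).hasFDerivAt).const_sub 1
  refine ((hasDerivAt_mul_sqrt (1 - ‖x‖ ^ 2)).comp_hasFDerivAt x h1).congr_fderiv ?_
  ext v
  simp [kern]
  ring

theorem contDiff_weight : ContDiff ℝ 1 (weight : E → ℝ) := by
  rw [contDiff_one_iff_fderiv]
  refine ⟨fun x => (hasFDerivAt_weight x).differentiableAt, ?_⟩
  have : fderiv ℝ (weight : E → ℝ) = fun x => -(kern x) • innerSL ℝ x :=
    funext fun x => (hasFDerivAt_weight x).fderiv
  rw [this]
  exact continuous_kern.neg.smul (innerSL ℝ).continuous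

variable [FiniteDimensional ℝ E] [MeasurableSpace E] [BorelSpace E]

theorem integrable_smul_of_eq_zero {ω : E → ℝ} (hω : Continuous ω)
    (h0 : ∀ x ∉ closedBall (0 : E) 1, ω x = 0) {H : E → W}
    (hH : ContinuousOn H (closedBall 0 1)) : Integrable (fun x => ω x • H x) := by
  rw [← integrableOn_iff_integrable_of_support_subset (s := closedBall (0 : E) 1)]
  · exact (hω.continuousOn.smul hH).integrableOn_compact (isCompact_closedBall 0 1)
  · intro x hx
    by_contra h
    exact hx (by simp [h0 x h])

/-- No boundary term appears because ω is C¹ on all of `E` and vanishes off the ball; `H` needs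
regularity only on the closed ball. -/
theorem integral_smul_fderiv_eq_neg {ω : E → ℝ} (hω : ContDiff ℝ 1 ω)
    (h0 : ∀ x ∉ closedBall (0 : E) 1, ω x = 0) {H : E → W}
    (hH : ∀ x ∈ closedBall (0 : E) 1, ContDiffAt ℝ 1 H x) (v : E) :
    ∫ x, ω x • fderiv ℝ H x v = -∫ x, fderiv ℝ ω x v • H x := by
  have hts : tsupport ω ⊆ closedBall (0 : E) 1 :=
    closure_minimal (fun x hx => by by_contra h; exact hx (h0 x h)) isClosed_closedBall
  have hc : ContinuousOn H (closedBall 0 1) := fun x hx =>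
    (hH x hx).continuousAt.continuousWithinAt
  have hc' : ContinuousOn (fun x => fderiv ℝ H x v) (closedBall 0 1) := fun x hx =>
    (((hH x hx).fderiv_right (m := 0) (by norm_num)).continuousAt.clm_apply
      continuousAt_const).continuousWithinAt
  refine integral_smul_fderiv_eq_neg_fderiv_smul_of_integrable ?_
    (integrable_smul_of_eq_zero hω.continuous h0 hc')
    (integrable_smul_of_eq_zero hω.continuous h0 hc)
    (fun x _ => hω.differentiable (by norm_num) x)
    (fun x hx => (hH x (hts hx)).differentiableAt (by norm_num))
  refine integrable_smul_of_eq_zero ((hω.continuous_fderiv (by norm_num)).clm_apply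
    continuous_const) (fun x hx => ?_) hc
  have : fderiv ℝ ω x = 0 := by
    have : x ∉ tsupport (fderiv ℝ ω) := fun h => hx (hts (tsupport_fderiv_subset ℝ h))
    exact image_eq_zero_of_notMem_tsupport this
  rw [this]
  rfl

theorem hasFDerivAt_inner_mul_weight (u x : E) :
    HasFDerivAt (fun x : E => ⟪u, x⟫ * weight x)
      (⟪u, x⟫ • (-(kern x) • innerSL ℝ x) + weight x • innerSL ℝ u) x :=
  (innerSL ℝ u).hasFDerivAt.mul (hasFDerivAt_weight x)

theorem contDiff_inner_mul_weight (u : E) : ContDiff ℝ 1 (fun x : E => ⟪u, x⟫ * weight x) :=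
  (innerSL ℝ u).contDiff.mul contDiff_weight

theorem integrable_kern_smul {H : E → W} (hH : ContinuousOn H (closedBall 0 1)) :
    Integrable (fun x => kern x • H x) :=
  integrable_smul_of_eq_zero continuous_kern (fun _ => kern_eq_zero) hH

theorem integrable_weight_smul {H : E → W} (hH : ContinuousOn H (closedBall 0 1)) :
    Integrable (fun x => weight x • H x) :=
  integrable_smul_of_eq_zero contDiff_weight.continuous (fun _ => weight_eq_zero) hH

/-- The derivative of `⟪u, x⟫ * weight x` in the direction `v` integrates to zero. -/
theorem integral_inner_mul_inner_kern (u v : E) :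
    ∫ x : E, kern x * (⟪u, x⟫ * ⟪v, x⟫) = ⟪u, v⟫ * ∫ x : E, weight x := by
  have h := integral_smul_fderiv_eq_neg (contDiff_inner_mul_weight u)
    (fun x hx => by rw [weight_eq_zero hx, mul_zero]) (H := fun _ : E => (1 : ℝ))
    (fun x _ => contDiffAt_const) v
  have i1 : Integrable fun x : E => kern x * (⟪u, x⟫ * ⟪v, x⟫) :=
    integrable_kern_smul (H := fun x : E => ⟪u, x⟫ * ⟪v, x⟫)
      ((continuous_const.inner continuous_id).mul
        (continuous_const.inner continuous_id)).continuousOn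
  have i2 : Integrable fun x : E => ⟪u, v⟫ * weight x := by
    simpa [mul_comm] using integrable_weight_smul (H := fun _ : E => ⟪u, v⟫) continuousOn_const
  have e : ∀ x : E, fderiv ℝ (fun x : E => ⟪u, x⟫ * weight x) x v • (1 : ℝ) =
      ⟪u, v⟫ * weight x - kern x * (⟪u, x⟫ * ⟪v, x⟫) := by
    intro x
    rw [(hasFDerivAt_inner_mul_weight u x).fderiv]
    simp [real_inner_comm v x]
    ring
  simp only [e, fderiv_fun_const, Pi.zero_apply, zero_apply, smul_zero,
    integral_zero] at h
  rw [integral_sub i2 i1, integral_const_mul] at h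
  linarith

/-- Trace the second moments over a basis and use `3 * weight x = kern x * (1 - ‖x‖ ^ 2)`. -/
theorem integral_kern :
    ∫ x : E, kern x = (Module.finrank ℝ E + 3) * ∫ x : E, weight x := by
  set b := stdOrthonormalBasis ℝ E
  have h1 : ∫ x : E, kern x * ‖x‖ ^ 2 = Module.finrank ℝ E * ∫ x : E, weight x := by
    have : ∀ x : E, kern x * ‖x‖ ^ 2 = ∑ i, kern x * (⟪b i, x⟫ * ⟪b i, x⟫) := by
      intro x
      rw [← Finset.mul_sum, ← b.sum_sq_inner_right x]
      simp only [pow_two]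
    simp only [this]
    rw [integral_finsetSum]
    · simp only [integral_inner_mul_inner_kern, real_inner_self_eq_norm_sq, b.orthonormal.1]
      simp
    · intro i _
      exact integrable_kern_smul (H := fun x : E => ⟪b i, x⟫ * ⟪b i, x⟫)
        ((continuous_const.inner continuous_id).mul
          (continuous_const.inner continuous_id)).continuousOn
  have i1 : Integrable (kern : E → ℝ) := by
    simpa using integrable_kern_smul (H := fun _ : E => (1 : ℝ)) continuousOn_const
  have i2 : Integrable (fun x : E => kern x * ‖x‖ ^ 2) :=
    integrable_kern_smul (H := fun x : E => ‖x‖ ^ 2) (by fun_prop)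
  have h2 : ∫ x : E, 3 * weight x = ∫ x : E, kern x - kern x * ‖x‖ ^ 2 := by
    congr 1
    ext x
    simp only [weight, kern]
    ring
  rw [integral_const_mul, integral_sub i1 i2, h1] at h2
  linarith

theorem integral_weight_pos : 0 < ∫ x : E, weight x := by
  have hk : 0 < ∫ x : E, kern x := by
    have i1 : Integrable (kern : E → ℝ) := by
      simpa using integrable_kern_smul (H := fun _ : E => (1 : ℝ)) continuousOn_const
    refine (continuous_kern (E := E)).integral_pos_of_hasCompactSupport_nonneg_nonzero ?_
      kern_nonneg (x := 0) ?_
    · exact HasCompactSupport.intro (isCompact_closedBall 0 1) fun x hx => kern_eq_zero hx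
    · simp [kern]
  rw [integral_kern] at hk
  exact pos_of_mul_pos_right hk (by positivity)

/-- Test ΔG = 0 against `⟪u, x⟫ * weight x` and integrate by parts: this yields the left side minus
`∫ weight • DG u`. A second integration by parts turns the latter into the right side. -/
theorem integral_kern_fderiv_self {G : E → W} (hG : HarmonicOnNhd G (closedBall 0 1)) (u : E) :
    ∫ x, kern x • ⟪u, x⟫ • fderiv ℝ G x x = ∫ x, kern x • ⟪u, x⟫ • G x := by
  set b := stdOrthonormalBasis ℝ E
  have hd : ∀ x ∈ closedBall (0 : E) 1, ContDiffAt ℝ 1 (fderiv ℝ G) x := fun x hx =>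
    (hG x hx).1.fderiv_right (by norm_num)
  have hdj : ∀ v : E, ∀ x ∈ closedBall (0 : E) 1, ContDiffAt ℝ 1 (fun x => fderiv ℝ G x v) x :=
    fun v x hx => (hd x hx).clm_apply contDiffAt_const
  have hdc : ∀ v : E, ContinuousOn (fun x => fderiv ℝ G x v) (closedBall 0 1) := fun v x hx =>
    (hdj v x hx).continuousAt.continuousWithinAt
  have hcu : ∀ u : E, Continuous fun x : E => ⟪u, x⟫ := fun u =>
    continuous_const.inner continuous_id
  have hj : ∀ j, ∫ x, (⟪u, x⟫ * weight x) • secondDeriv G x (b j) =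
      (∫ x, kern x • ⟪u, x⟫ • ⟪b j, x⟫ • fderiv ℝ G x (b j)) -
        ∫ x, weight x • ⟪u, b j⟫ • fderiv ℝ G x (b j) := by
    intro j
    have h := integral_smul_fderiv_eq_neg (contDiff_inner_mul_weight u)
      (fun x hx => by rw [weight_eq_zero hx, mul_zero]) (hdj (b j)) (b j)
    have e1 : ∀ x : E, (⟪u, x⟫ * weight x) • fderiv ℝ (fun x => fderiv ℝ G x (b j)) x (b j) =
        (⟪u, x⟫ * weight x) • secondDeriv G x (b j) := by
      intro x
      by_cases hx : x ∈ closedBall (0 : E) 1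
      · congr 1
        rw [secondDeriv, fderiv_clm_apply ((hd x hx).differentiableAt (by norm_num))
          (differentiableAt_const _)]
        simp
      · simp [weight_eq_zero hx]
    simp only [e1] at h
    rw [h, ← integral_sub, ← integral_neg]
    · congr 1
      ext x
      rw [(hasFDerivAt_inner_mul_weight u x).fderiv]
      simp only [add_apply, smul_apply, innerSL_apply_apply,
        smul_eq_mul, real_inner_comm (b j) x]
      module
    · exact integrable_kern_smul ((hcu u).continuousOn.smul ((hcu _).continuousOn.smul (hdc _)))
    · exact integrable_weight_smul (continuousOn_const.smul (hdc _))
  have hsum : ∑ j, ∫ x, (⟪u, x⟫ * weight x) • secondDeriv G x (b j) = 0 := by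
    rw [← integral_finsetSum]
    · rw [← integral_zero E W]
      congr 1
      ext x
      rw [← Finset.smul_sum, ← laplacian_eq_sum_secondDeriv]
      by_cases hx : x ∈ closedBall (0 : E) 1
      · rw [(hG x hx).2.self_of_nhds]
        simp
      · simp [weight_eq_zero hx]
    · intro j _
      refine integrable_smul_of_eq_zero (contDiff_inner_mul_weight u).continuous
        (fun x hx => by rw [weight_eq_zero hx, mul_zero]) fun x hx => ?_
      exact (((((hd x hx).fderiv_right (m := 0) (by norm_num)).continuousAt.clm_apply
        continuousAt_const).clm_apply continuousAt_const)).continuousWithinAt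
  simp only [hj] at hsum
  rw [Finset.sum_sub_distrib, ← integral_finsetSum, ← integral_finsetSum, sub_eq_zero] at hsum
  · have e1 : ∀ x, ∑ j, kern x • ⟪u, x⟫ • ⟪b j, x⟫ • fderiv ℝ G x (b j) =
        kern x • ⟪u, x⟫ • fderiv ℝ G x x := by
      intro x
      rw [← Finset.smul_sum, ← Finset.smul_sum]
      rw [sum_inner_smul_apply]
    have e2 : ∀ x, ∑ j, weight x • ⟪u, b j⟫ • fderiv ℝ G x (b j) =
        weight x • fderiv ℝ G x u := by
      intro x
      simp only [real_inner_comm _ u]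
      rw [← Finset.smul_sum, sum_inner_smul_apply]
    simp only [e1, e2] at hsum
    rw [hsum, integral_smul_fderiv_eq_neg contDiff_weight (fun x hx => weight_eq_zero hx)
      (fun x hx => (hG x hx).1.of_le (by norm_num)), ← integral_neg]
    congr 1
    ext x
    rw [(hasFDerivAt_weight x).fderiv]
    simp only [smul_apply, innerSL_apply_apply, real_inner_comm u x]
    module
  · exact fun j _ => integrable_weight_smul (continuousOn_const.smul (hdc _))
  · exact fun j _ => integrable_kern_smul
      ((hcu u).continuousOn.smul ((hcu _).continuousOn.smul (hdc _)))

end Weight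

/-! ### A mean value formula for the derivative at the centre -/

section GradientBound

open MeasureTheory

variable {E : Type*} [NormedAddCommGroup E] [InnerProductSpace ℝ E] [FiniteDimensional ℝ E]
  [MeasurableSpace E] [BorelSpace E] {W : Type*} [NormedAddCommGroup W] [NormedSpace ℝ W]

theorem smul_mem_closedBall {r s : ℝ} (hr : |r| ≤ s) {x : E} (hx : x ∈ closedBall (0 : E) 1) :
    r • x ∈ closedBall (0 : E) s := by
  rw [mem_closedBall_zero_iff] at hx ⊢
  rw [norm_smul, Real.norm_eq_abs]
  nlinarith [abs_nonneg r, norm_nonneg x]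

theorem hasDerivAt_integral_kern_comp_smul {F : E → W} (hF : HarmonicOnNhd F (ball 0 1)) (u : E)
    {r : ℝ} (hr : |r| < 1) :
    HasDerivAt (fun r : ℝ => ∫ x, kern x • ⟪u, x⟫ • F (r • x))
      (∫ x, kern x • ⟪u, x⟫ • fderiv ℝ F (r • x) x) r := by
  obtain ⟨s, hrs, hs1⟩ := exists_between hr
  have hsub : closedBall (0 : E) s ⊆ ball 0 1 := closedBall_subset_ball hs1
  have hcF : ContinuousOn F (closedBall 0 s) := hF.continuousOn.mono hsub
  have hcD : ContinuousOn (fderiv ℝ F) (closedBall 0 s) := fun x hx =>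
    ((hF x (hsub hx)).1.fderiv_right (m := 0) (by norm_num)).continuousAt.continuousWithinAt
  obtain ⟨C, hC⟩ := (isCompact_closedBall (0 : E) s).exists_bound_of_continuousOn hcD
  have hcu : Continuous fun x : E => ⟪u, x⟫ := continuous_const.inner continuous_id
  have hint : ∀ t : ℝ, |t| < s → Integrable fun x => kern x • ⟪u, x⟫ • F (t • x) := fun t ht =>
    integrable_kern_smul (hcu.continuousOn.smul (hcF.comp (by fun_prop)
      fun x hx => smul_mem_closedBall ht.le hx))
  have hopen : {t : ℝ | |t| < s} ∈ 𝓝 r := (isOpen_lt continuous_abs continuous_const).mem_nhds hrs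
  refine (hasDerivAt_integral_of_dominated_loc_of_deriv_le (s := {t : ℝ | |t| < s})
    (bound := fun x => kern x • (|⟪u, x⟫| * (C * ‖x‖)))
    (F' := fun r x => kern x • ⟪u, x⟫ • fderiv ℝ F (r • x) x) hopen ?_ (hint r hrs) ?_ ?_ ?_ ?_).2
  · filter_upwards [hopen] with t ht using (hint t ht).aestronglyMeasurable
  · refine (integrable_kern_smul (hcu.continuousOn.smul ?_)).aestronglyMeasurable
    exact (hcD.comp (by fun_prop) fun x hx => smul_mem_closedBall hrs.le hx).clm_apply
      continuousOn_id
  · refine Eventually.of_forall fun x t ht => ?_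
    by_cases hx : x ∈ closedBall (0 : E) 1
    · rw [norm_smul, norm_smul, Real.norm_of_nonneg (kern_nonneg x), smul_eq_mul, Real.norm_eq_abs]
      have h1 : ‖fderiv ℝ F (t • x) x‖ ≤ C * ‖x‖ :=
        (ContinuousLinearMap.le_opNorm _ _).trans (mul_le_mul_of_nonneg_right
          (hC _ (smul_mem_closedBall (le_of_lt ht) hx)) (norm_nonneg _))
      have := kern_nonneg x
      gcongr
    · simp [kern_eq_zero hx]
  · exact integrable_kern_smul (by fun_prop)
  · refine Eventually.of_forall fun x t ht => ?_
    by_cases hx : x ∈ closedBall (0 : E) 1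
    · have h1 := (hF _ (hsub (smul_mem_closedBall (le_of_lt ht) hx))).1.differentiableAt
        (by norm_num)
      have h2 : HasDerivAt (fun t : ℝ => t • x) x t := by
        simpa using (hasDerivAt_id t).smul_const x
      exact ((h1.hasFDerivAt.comp_hasDerivAt t h2).const_smul ⟪u, x⟫).const_smul (kern x)
    · simpa [kern_eq_zero hx] using hasDerivAt_const t (0 : W)

theorem smul_integral_kern_fderiv_comp_smul {F : E → W} (hF : HarmonicOnNhd F (ball 0 1)) (u : E)
    {r : ℝ} (hr : |r| < 1) :
    r • ∫ x, kern x • ⟪u, x⟫ • fderiv ℝ F (r • x) x = ∫ x, kern x • ⟪u, x⟫ • F (r • x) := by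
  obtain ⟨s, hs1, hs⟩ : ∃ s : ℝ, 1 < s ∧ |r| * s < 1 := by
    -- Any `s` strictly between 1 and `1 / |r|` would do; this choice also covers `r = 0`.
    refine ⟨2 / (1 + |r|), ?_, ?_⟩
    · rw [lt_div_iff₀ (by positivity)]; linarith
    · rw [← mul_div_assoc, div_lt_one (by positivity)]; linarith
  have hmem : ∀ x ∈ ball (0 : E) s, r • x ∈ ball (0 : E) 1 := by
    intro x hx
    rw [mem_ball_zero_iff] at hx ⊢
    rw [norm_smul, Real.norm_eq_abs]
    nlinarith [abs_nonneg r]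
  have hG : HarmonicOnNhd (fun x => F (r • x)) (ball 0 s) := by
    simpa using harmonicOnNhd_comp_similarity isOpen_ball 0 r (LinearIsometryEquiv.refl ℝ E) hF
      (by simpa using hmem)
  rw [← integral_kern_fderiv_self (hG.mono (closedBall_subset_ball hs1)) u, ← integral_smul]
  congr 1
  ext x
  by_cases hx : x ∈ closedBall (0 : E) 1
  · have h1 := (hF _ (hmem x (closedBall_subset_ball hs1 hx))).1.differentiableAt (by norm_num)
    have h2 : HasFDerivAt (fun x : E => r • x) (r • ContinuousLinearMap.id ℝ E) x :=
      (hasFDerivAt_id x).const_smul r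
    have h3 := (h1.hasFDerivAt.comp x h2).fderiv
    simp only [Function.comp_def] at h3
    rw [h3]
    simp only [ContinuousLinearMap.comp_apply, smul_apply,
      ContinuousLinearMap.id_apply, map_smul]
    module
  · simp [kern_eq_zero hx]

/-- The left side `K r` satisfies Euler's relation `r K' = K`, so `K r / r` is constant on `(0, 1)`.
Its limit at 0 is `K' 0`, computed from the second moments of `kern`. -/
theorem integral_kern_comp_smul [CompleteSpace W] {F : E → W} (hF : HarmonicOnNhd F (ball 0 1)) (u : E)
    {r : ℝ} (hr0 : 0 < r) (hr : r < 1) :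
    ∫ x, kern x • ⟪u, x⟫ • F (r • x) = (r * ∫ x : E, weight x) • fderiv ℝ F 0 u := by
  set b := stdOrthonormalBasis ℝ E
  set K : ℝ → W := fun r => ∫ x, kern x • ⟪u, x⟫ • F (r • x) with hK
  have hKd : ∀ t : ℝ, |t| < 1 → HasDerivAt K (∫ x, kern x • ⟪u, x⟫ • fderiv ℝ F (t • x) x) t :=
    fun t ht => hasDerivAt_integral_kern_comp_smul hF u ht
  have hKe : ∀ t : ℝ, |t| < 1 → t • ∫ x, kern x • ⟪u, x⟫ • fderiv ℝ F (t • x) x = K t :=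
    fun t ht => smul_integral_kern_fderiv_comp_smul hF u ht
  have hK0 : K 0 = 0 := by rw [← hKe 0 (by simp), zero_smul]
  have hd0 : ∫ x, kern x • ⟪u, x⟫ • fderiv ℝ F ((0 : ℝ) • x) x =
      (∫ x : E, weight x) • fderiv ℝ F 0 u := by
    have e : ∀ x : E, kern x • ⟪u, x⟫ • fderiv ℝ F ((0 : ℝ) • x) x =
        ∑ j, (kern x * (⟪u, x⟫ * ⟪b j, x⟫)) • fderiv ℝ F 0 (b j) := by
      intro x
      rw [zero_smul, ← sum_inner_smul_apply b (fderiv ℝ F 0) x, Finset.smul_sum, Finset.smul_sum]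
      simp only [smul_smul]
    simp only [e]
    rw [integral_finsetSum]
    · simp only [integral_smul_const, integral_inner_mul_inner_kern]
      rw [← sum_inner_smul_apply b (fderiv ℝ F 0) u, Finset.smul_sum]
      simp only [smul_smul, real_inner_comm u, mul_comm]
    · intro j _
      exact (integrable_kern_smul (H := fun x : E => ⟪u, x⟫ * ⟪b j, x⟫) (by fun_prop)).smul_const _
  have hconst : ∀ t ∈ Set.Ioo (0 : ℝ) 1, t⁻¹ • K t = r⁻¹ • K r := by
    intro t ht
    have hder : ∀ t ∈ Set.Ioo (0 : ℝ) 1, HasDerivAt (fun t : ℝ => t⁻¹ • K t) 0 t := by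
      intro t ht
      have ht1 : |t| < 1 := by rw [abs_of_pos ht.1]; exact ht.2
      refine ((hasDerivAt_inv ht.1.ne').smul (hKd t ht1)).congr_deriv ?_
      have h0 : t ≠ 0 := ht.1.ne'
      rw [← hKe t ht1, smul_smul, ← add_smul]
      have : t⁻¹ + -(t ^ 2)⁻¹ * t = 0 := by field_simp; ring
      rw [this, zero_smul]
    exact isOpen_Ioo.is_const_of_deriv_eq_zero isPreconnected_Ioo
      (fun t ht => (hder t ht).differentiableAt.differentiableWithinAt)
      (fun t ht => (hder t ht).deriv) ht ⟨hr0, hr⟩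
  have hlim : Tendsto (fun t : ℝ => t⁻¹ • K t) (𝓝[>] 0)
      (𝓝 ((∫ x : E, weight x) • fderiv ℝ F 0 u)) := by
    have := (hKd 0 (by simp)).tendsto_slope_zero_right
    simpa only [zero_add, hK0, sub_zero, hd0] using this
  have hlim2 : Tendsto (fun t : ℝ => t⁻¹ • K t) (𝓝[>] 0) (𝓝 (r⁻¹ • K r)) := by
    refine tendsto_const_nhds.congr' ?_
    filter_upwards [Ioo_mem_nhdsGT (zero_lt_one' ℝ)] with t ht using (hconst t ht).symm
  have := tendsto_nhds_unique hlim2 hlim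
  rw [mul_smul, ← this, smul_smul, mul_inv_cancel₀ hr0.ne', one_smul]

end GradientBound

/-! ### The Hilbert–Schmidt bound at the centre -/

section HilbertSchmidt

open MeasureTheory

variable {E : Type*} [NormedAddCommGroup E] [InnerProductSpace ℝ E] [FiniteDimensional ℝ E]
  {W : Type*} [NormedAddCommGroup W] [InnerProductSpace ℝ W] [CompleteSpace W]

/-- With A = DF(0), integrate 2r⟨Ax, F(rx)⟩ ≤ r²|Ax|² + M² against `kern`. The left side gives `2 *
r ^ 2 * w * S`, the first term on the right `r ^ 2 * w * S`, and the total mass of `kern` is `(N +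
3) * w`. -/
theorem sum_norm_sq_fderiv_le_of_lt_one [MeasurableSpace E] [BorelSpace E]
    {F : E → W} (hF : HarmonicOnNhd F (ball 0 1)) {M : ℝ}
    (hb : ∀ x ∈ ball (0 : E) 1, ‖F x‖ ≤ M) {ι : Type*} [Fintype ι] (b : OrthonormalBasis ι ℝ E)
    {r : ℝ} (hr0 : 0 < r) (hr : r < 1) :
    r ^ 2 * ∑ i, ‖fderiv ℝ F 0 (b i)‖ ^ 2 ≤ (Module.finrank ℝ E + 3) * M ^ 2 := by
  set A := fderiv ℝ F 0 with hA
  set w := ∫ x : E, weight x with hw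
  have hwpos : 0 < w := integral_weight_pos
  set S := ∑ i, ‖A (b i)‖ ^ 2 with hS
  have hrx : ∀ x ∈ closedBall (0 : E) 1, r • x ∈ ball (0 : E) 1 := fun x hx =>
    closedBall_subset_ball hr (smul_mem_closedBall (abs_of_pos hr0).le hx)
  have hcF : ContinuousOn (fun x => F (r • x)) (closedBall 0 1) :=
    hF.continuousOn.comp (by fun_prop) hrx
  have hM : 0 ≤ M := (norm_nonneg _).trans (hb 0 (by simp))
  have h1 : ∫ x, kern x • ⟪A x, F (r • x)⟫ = r * w * S := by
    have e : ∀ x, kern x • ⟪A x, F (r • x)⟫ =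
        ∑ i, ⟪A (b i), kern x • ⟪b i, x⟫ • F (r • x)⟫ := by
      intro x
      conv_lhs => rw [← sum_inner_smul_apply b A x]
      rw [sum_inner, smul_eq_mul, Finset.mul_sum]
      simp only [real_inner_smul_left, real_inner_smul_right]
    simp only [e]
    rw [integral_finsetSum]
    · have : ∀ i, ∫ x, ⟪A (b i), kern x • ⟪b i, x⟫ • F (r • x)⟫ = r * w * ‖A (b i)‖ ^ 2 := by
        intro i
        rw [integral_inner (integrable_kern_smul (H := fun x => ⟪b i, x⟫ • F (r • x))
          (ContinuousOn.smul (by fun_prop) hcF)),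
          integral_kern_comp_smul hF (b i) hr0 hr, real_inner_smul_right,
          real_inner_self_eq_norm_sq]
      simp only [this]
      rw [← Finset.mul_sum]
    · intro i _
      exact (integrable_kern_smul (ContinuousOn.smul (by fun_prop) hcF)).const_inner _
  have h2 : ∫ x, kern x • ‖A x‖ ^ 2 = w * S := by
    have e : ∀ x, kern x • ‖A x‖ ^ 2 =
        ∑ i, ∑ j, (kern x * (⟪b i, x⟫ * ⟪b j, x⟫)) * ⟪A (b i), A (b j)⟫ := by
      intro x
      rw [← real_inner_self_eq_norm_sq]
      conv_lhs => rw [← sum_inner_smul_apply b A x]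
      rw [sum_inner, smul_eq_mul, Finset.mul_sum]
      simp only [inner_sum, Finset.mul_sum, real_inner_smul_left, real_inner_smul_right]
      exact Finset.sum_congr rfl fun i _ => Finset.sum_congr rfl fun j _ => by ring
    have hi : ∀ i j, Integrable fun x : E =>
        (kern x * (⟪b i, x⟫ * ⟪b j, x⟫)) * ⟪A (b i), A (b j)⟫ := fun i j =>
      (integrable_kern_smul (H := fun x : E => ⟪b i, x⟫ * ⟪b j, x⟫) (by fun_prop)).mul_const _
    simp only [e]
    rw [integral_finsetSum _ fun i _ => integrable_finsetSum _ fun j _ => hi i j]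
    simp only [integral_finsetSum _ fun j _ => hi _ j, integral_mul_const,
      integral_inner_mul_inner_kern]
    classical
    simp only [orthonormal_iff_ite.1 b.orthonormal, ite_mul, one_mul, zero_mul,
      Finset.sum_ite_eq, Finset.mem_univ, if_true, real_inner_self_eq_norm_sq]
    rw [Finset.mul_sum]
  have i1 : Integrable fun x => kern x • ⟪A x, F (r • x)⟫ :=
    integrable_kern_smul (ContinuousOn.inner A.continuous.continuousOn hcF)
  have i2 : Integrable fun x => kern x • ‖A x‖ ^ 2 :=
    integrable_kern_smul (by fun_prop)
  have i3 : Integrable (kern : E → ℝ) := by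
    simpa using integrable_kern_smul (H := fun _ : E => (1 : ℝ)) continuousOn_const
  have h3 : 2 * r * ∫ x, kern x • ⟪A x, F (r • x)⟫ ≤
      r ^ 2 * (∫ x, kern x • ‖A x‖ ^ 2) + (∫ x : E, kern x) * M ^ 2 := by
    rw [← integral_const_mul, ← integral_const_mul, ← integral_mul_const,
      ← integral_add (i2.const_mul _) (i3.mul_const _)]
    refine integral_mono (i1.const_mul _) ((i2.const_mul _).add (i3.mul_const _)) fun x => ?_
    by_cases hx : x ∈ closedBall (0 : E) 1
    · have a1 : ⟪A x, F (r • x)⟫ ≤ ‖A x‖ * M := (real_inner_le_norm _ _).trans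
        (mul_le_mul_of_nonneg_left (hb _ (hrx x hx)) (norm_nonneg _))
      have a2 : 2 * r * ⟪A x, F (r • x)⟫ ≤ r ^ 2 * ‖A x‖ ^ 2 + M ^ 2 := by
        nlinarith [sq_nonneg (r * ‖A x‖ - M), mul_le_mul_of_nonneg_left a1 hr0.le]
      have := mul_le_mul_of_nonneg_left a2 (kern_nonneg x)
      simp only [smul_eq_mul]
      linarith
    · simp [kern_eq_zero hx]
  rw [h1, h2, integral_kern, ← hw] at h3
  have h4 : w * (r ^ 2 * S) ≤ w * ((Module.finrank ℝ E + 3) * M ^ 2) := by linarith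
  exact le_of_mul_le_mul_left h4 hwpos

/-- The Hilbert–Schmidt norm of the derivative at the centre of a harmonic map of the unit ball
into the ball of radius `M`. -/
theorem sum_norm_sq_fderiv_le {F : E → W} (hF : HarmonicOnNhd F (ball 0 1)) {M : ℝ}
    (hb : ∀ x ∈ ball (0 : E) 1, ‖F x‖ ≤ M) {ι : Type*} [Fintype ι]
    (b : OrthonormalBasis ι ℝ E) :
    ∑ i, ‖fderiv ℝ F 0 (b i)‖ ^ 2 ≤ (Module.finrank ℝ E + 3) * M ^ 2 := by
  borelize E
  have hc : Tendsto (fun r : ℝ => r ^ 2 * ∑ i, ‖fderiv ℝ F 0 (b i)‖ ^ 2) (𝓝[<] 1)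
      (𝓝 (∑ i, ‖fderiv ℝ F 0 (b i)‖ ^ 2)) := by
    have : ContinuousAt (fun r : ℝ => r ^ 2 * ∑ i, ‖fderiv ℝ F 0 (b i)‖ ^ 2) 1 := by fun_prop
    simpa using this.tendsto.mono_left (nhdsWithin_le_nhds (s := Set.Iio (1 : ℝ)))
  refine le_of_tendsto hc ?_
  filter_upwards [Ioo_mem_nhdsLT (zero_lt_one' ℝ)] with r hr
  exact sum_norm_sq_fderiv_le_of_lt_one hF hb b hr.1 hr.2

end HilbertSchmidt

/-! ### The Clifford norm of 1 - āx -/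

section Clifford

open CliffordHarmonic

variable {n : ℕ}

theorem coords_blade (A : Finset (Fin n)) : coords n (blade A) = EuclideanSpace.single A 1 := by
  rw [← bladeBasis_apply]
  ext B
  simp [coords, Finsupp.single_apply, eq_comm]

theorem norm_coords (c : Cl n) : ‖coords n c‖ = ‖c‖ := rfl

theorem norm_sq_sum_smul_blade {κ : Type*} [Fintype κ] {s : κ → Finset (Fin n)}
    (hs : Function.Injective s) (c : κ → ℝ) : ‖∑ k, c k • blade (s k)‖ ^ 2 = ∑ k, c k ^ 2 := by
  have ho : Orthonormal ℝ fun k => coords n (blade (s k)) := by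
    simp only [coords_blade]
    exact (EuclideanSpace.orthonormal_single (𝕜 := ℝ) (ι := Finset (Fin n))).comp s hs
  rw [← norm_coords, ← real_inner_self_eq_norm_sq, map_sum]
  simp only [map_smul]
  rw [ho.inner_sum]
  simp [pow_two]

theorem blade_empty : blade (∅ : Finset (Fin n)) = 1 := by simp [blade]

theorem blade_singleton (i : Fin n) : blade {i} = imUnit i := by simp [blade]

theorem blade_pair {i j : Fin n} (h : i < j) : blade {i, j} = imUnit i * imUnit j := by
  rw [blade, Finset.sort_insert (r := (· ≤ ·))]
  · simp
  · simpa using h.le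
  · simpa using h.ne

theorem imUnit_mul_self (i : Fin n) : (imUnit i : Cl n) * imUnit i = -1 := by
  have : negSq n (Pi.single i 1) = -1 := by
    simp [negSq, QuadraticMap.weightedSumSquares_apply, Pi.single_apply]
  rw [imUnit, CliffordAlgebra.ι_sq_scalar, this, map_neg, map_one]

theorem imUnit_mul_comm {i j : Fin n} (h : i ≠ j) :
    (imUnit j : Cl n) * imUnit i = -(imUnit i * imUnit j) := by
  have : QuadraticMap.polar (negSq n) (Pi.single i 1) (Pi.single j 1) = 0 := by
    have h1 := QuadraticMap.two_nsmul_associated ℝ (-negSq n)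
    have h2 := DFunLike.congr_fun (DFunLike.congr_fun h1 (Pi.single i 1)) (Pi.single j 1)
    rw [LinearMap.smul_apply, LinearMap.smul_apply, associated_neg_negSq_single i j h] at h2
    simpa [QuadraticMap.polar_neg] using h2
  have h2 := CliffordAlgebra.ι_mul_ι_add_swap (Q := negSq n) (Pi.single i 1) (Pi.single j 1)
  rw [this, map_zero] at h2
  exact eq_neg_of_add_eq_zero_right h2

theorem sum_sum_eq_sum_lt_add_sum_diag {M : Type*} [AddCommMonoid M] (f : Fin n → Fin n → M) :
    ∑ i, ∑ j, f i j =
      ∑ p : {p : Fin n × Fin n // p.1 < p.2}, (f p.1.1 p.1.2 + f p.1.2 p.1.1) + ∑ i, f i i := by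
  have h1 : ∀ i j, f i j = (if i < j then f i j else 0) + (if j < i then f i j else 0) +
      (if i = j then f i j else 0) := by
    intro i j
    rcases lt_trichotomy i j with h | h | h
    · simp [h, h.not_gt, h.ne]
    · simp [h]
    · simp [h, h.not_gt, h.ne']
  have h2 : ∑ p : {p : Fin n × Fin n // p.1 < p.2}, (f p.1.1 p.1.2 + f p.1.2 p.1.1) =
      ∑ i, ∑ j, if i < j then f i j + f j i else 0 := by
    rw [← Fintype.sum_prod_type' (f := fun i j => if i < j then f i j + f j i else 0),
      ← Finset.sum_filter]
    exact (Finset.sum_subtype (Finset.univ.filter fun p : Fin n × Fin n => p.1 < p.2) (by simp)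
      (fun p => f p.1 p.2 + f p.2 p.1)).symm
  rw [h2]
  rw [Finset.sum_congr rfl fun i _ => Finset.sum_congr rfl fun j _ => h1 i j]
  simp only [Finset.sum_add_distrib]
  rw [Finset.sum_comm (f := fun i j => if j < i then f i j else 0), ← Finset.sum_add_distrib]
  congr 1
  · refine Finset.sum_congr rfl fun i _ => ?_
    rw [← Finset.sum_add_distrib]
    refine Finset.sum_congr rfl fun j _ => ?_
    split_ifs <;> simp
  · simp

/-- Distinct index sets of size at most 2 give orthonormal blades, so the norm of `1 - āx` can be
read off its coefficients. -/
theorem injective_smallSets : Function.Injective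
    (fun k : Option (Fin n ⊕ {p : Fin n × Fin n // p.1 < p.2}) =>
      (k.elim ∅ (Sum.elim (fun i => {i}) fun p => {p.1.1, p.1.2}) : Finset (Fin n))) := by
  rintro (_ | i | ⟨⟨i, j⟩, h⟩) (_ | i' | ⟨⟨i', j'⟩, h'⟩) e <;>
    simp only [Option.elim, Sum.elim_inl, Sum.elim_inr] at e <;> try rfl
  · exact absurd e.symm (Finset.singleton_ne_empty _)
  · exact absurd e.symm (Finset.insert_ne_empty _ _)
  · exact absurd e (Finset.singleton_ne_empty _)
  · rw [Finset.singleton_injective e]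
  · have := congrArg Finset.card e
    rw [Finset.card_singleton, Finset.card_pair h'.ne] at this
    norm_num at this
  · exact absurd e (Finset.insert_ne_empty _ _)
  · have := congrArg Finset.card e
    rw [Finset.card_singleton, Finset.card_pair h.ne] at this
    norm_num at this
  · have h1 : i ∈ ({i', j'} : Finset (Fin n)) := e ▸ by simp
    have h2 : j ∈ ({i', j'} : Finset (Fin n)) := e ▸ by simp
    have h3 : i' ∈ ({i, j} : Finset (Fin n)) := e ▸ by simp
    simp only [Finset.mem_insert, Finset.mem_singleton] at h1 h2 h3
    have h4 : i = i' ∧ j = j' := by simp only at h h'; omega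
    simp only [h4.1, h4.2]

theorem star_paravector_mul_paravector (a x : EuclideanSpace ℝ (Fin (n + 1))) :
    1 - star (paravector a) * paravector x = (1 - ⟪a, x⟫) • (1 : Cl n) +
      (∑ i : Fin n, (x 0 * a i.succ - a 0 * x i.succ) • imUnit i +
      ∑ p : {p : Fin n × Fin n // p.1 < p.2},
        (a p.1.1.succ * x p.1.2.succ - a p.1.2.succ * x p.1.1.succ) •
          (imUnit p.1.1 * imUnit p.1.2 : Cl n)) := by
  have hs : star (paravector a) = algebraMap ℝ (Cl n) (a 0) -
      ∑ i : Fin n, a i.succ • (imUnit i : Cl n) := by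
    rw [paravector, star_add, star_sum, CliffordAlgebra.star_algebraMap, sub_eq_add_neg,
      ← Finset.sum_neg_distrib]
    simp [imUnit, CliffordAlgebra.star_smul, CliffordAlgebra.star_ι]
  have hp : (∑ i : Fin n, a i.succ • (imUnit i : Cl n)) * ∑ j : Fin n, x j.succ • imUnit j =
      (∑ p : {p : Fin n × Fin n // p.1 < p.2},
        (a p.1.1.succ * x p.1.2.succ - a p.1.2.succ * x p.1.1.succ) •
          (imUnit p.1.1 * imUnit p.1.2 : Cl n)) -
      (∑ i : Fin n, a i.succ * x i.succ) • 1 := by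
    rw [Finset.sum_mul_sum, sum_sum_eq_sum_lt_add_sum_diag, sub_eq_add_neg, Finset.sum_smul,
      ← Finset.sum_neg_distrib]
    congr 1
    · refine Finset.sum_congr rfl fun p _ => ?_
      simp only [smul_mul_smul_comm]
      rw [imUnit_mul_comm p.2.ne]
      module
    · refine Finset.sum_congr rfl fun i _ => ?_
      rw [smul_mul_smul_comm, imUnit_mul_self]
      module
  have hi : ⟪a, x⟫ = a 0 * x 0 + ∑ i : Fin n, a i.succ * x i.succ := by
    rw [PiLp.inner_apply, Fin.sum_univ_succ]
    simp [mul_comm]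
  have hl : ∑ i : Fin n, (x 0 * a i.succ - a 0 * x i.succ) • (imUnit i : Cl n) =
      x 0 • ∑ i : Fin n, a i.succ • imUnit i - a 0 • ∑ i : Fin n, x i.succ • imUnit i := by
    simp only [Finset.smul_sum, ← Finset.sum_sub_distrib, sub_smul, smul_smul]
  rw [hs, paravector, sub_mul, mul_add, mul_add, hp, hi, hl, Algebra.algebraMap_eq_smul_one,
    Algebra.algebraMap_eq_smul_one, smul_mul_smul_comm, smul_one_mul, mul_smul_one, mul_one]
  module

/-- Add the squares of the scalar, vector and bivector coefficients; Lagrange's identity evaluates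
the bivector part. -/
theorem norm_sq_one_sub_star_paravector_mul (a x : EuclideanSpace ℝ (Fin (n + 1))) :
    ‖1 - star (paravector a) * paravector x‖ ^ 2 = 1 - 2 * ⟪a, x⟫ + ‖a‖ ^ 2 * ‖x‖ ^ 2 := by
  have h := norm_sq_sum_smul_blade (injective_smallSets (n := n))
    (fun k => k.elim (1 - ⟪a, x⟫) (Sum.elim (fun i => x 0 * a i.succ - a 0 * x i.succ)
      fun p => a p.1.1.succ * x p.1.2.succ - a p.1.2.succ * x p.1.1.succ))
  simp only [Fintype.sum_option, Fintype.sum_sum_type, Option.elim, Sum.elim_inl, Sum.elim_inr,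
    blade_empty, blade_singleton] at h
  have hb : ∀ p : {p : Fin n × Fin n // p.1 < p.2},
      blade {p.1.1, p.1.2} = (imUnit p.1.1 * imUnit p.1.2 : Cl n) := fun p => blade_pair p.2
  simp only [hb] at h
  rw [star_paravector_mul_paravector, h]
  have hL := sum_sum_eq_sum_lt_add_sum_diag (fun i j : Fin n =>
    a i.succ ^ 2 * x j.succ ^ 2 - (a i.succ * x i.succ) * (a j.succ * x j.succ))
  have e1 : ∀ p : {p : Fin n × Fin n // p.1 < p.2},
      (a p.1.1.succ ^ 2 * x p.1.2.succ ^ 2 -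
        (a p.1.1.succ * x p.1.1.succ) * (a p.1.2.succ * x p.1.2.succ)) +
      (a p.1.2.succ ^ 2 * x p.1.1.succ ^ 2 -
        (a p.1.2.succ * x p.1.2.succ) * (a p.1.1.succ * x p.1.1.succ)) =
      (a p.1.1.succ * x p.1.2.succ - a p.1.2.succ * x p.1.1.succ) ^ 2 := fun p => by ring
  have e2 : ∀ i : Fin n, a i.succ ^ 2 * x i.succ ^ 2 -
      (a i.succ * x i.succ) * (a i.succ * x i.succ) = 0 := fun i => by ring
  simp only [e1, e2, Finset.sum_const_zero, add_zero, Finset.sum_sub_distrib, ← Finset.mul_sum,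
    ← Finset.sum_mul] at hL
  have hi : ⟪a, x⟫ = a 0 * x 0 + ∑ i : Fin n, a i.succ * x i.succ := by
    rw [PiLp.inner_apply, Fin.sum_univ_succ]
    simp [mul_comm]
  have hn : ∀ y : EuclideanSpace ℝ (Fin (n + 1)),
      ‖y‖ ^ 2 = y 0 ^ 2 + ∑ i : Fin n, y i.succ ^ 2 := by
    intro y
    rw [EuclideanSpace.norm_sq_eq, Fin.sum_univ_succ]
    simp
  have h3 : ∑ i : Fin n, (x 0 * a i.succ - a 0 * x i.succ) ^ 2 =
      x 0 ^ 2 * ∑ i : Fin n, a i.succ ^ 2 - 2 * a 0 * x 0 * ∑ i : Fin n, a i.succ * x i.succ +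
        a 0 ^ 2 * ∑ i : Fin n, x i.succ ^ 2 := by
    simp only [Finset.mul_sum, ← Finset.sum_sub_distrib, ← Finset.sum_add_distrib]
    exact Finset.sum_congr rfl fun i _ => by ring
  rw [← hL, h3, hi, hn a, hn x]
  ring

end Clifford

/-! ### The inversion of the ball exchanging 0 and a -/

section BallInversion

open EuclideanGeometry

variable {E : Type*} [NormedAddCommGroup E] [InnerProductSpace ℝ E]

/-- The centre `a / |a|²` of the inversion of the unit ball that exchanges `0` and `a`. -/
noncomputable def invCenter (a : E) : E := (‖a‖ ^ 2)⁻¹ • a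

/-- The radius of the inversion of the unit ball that exchanges `0` and `a`. -/
noncomputable def invRadius (a : E) : ℝ := √(1 - ‖a‖ ^ 2) / ‖a‖

variable {a : E}

theorem norm_invCenter (a : E) : ‖invCenter a‖ = ‖a‖⁻¹ := by
  rw [invCenter, norm_smul, norm_inv, norm_pow, norm_norm]
  rcases eq_or_ne ‖a‖ 0 with h | h
  · simp [h]
  · field_simp

theorem invRadius_sq (ha1 : ‖a‖ < 1) : invRadius a ^ 2 = (1 - ‖a‖ ^ 2) / ‖a‖ ^ 2 := by
  rw [invRadius, div_pow, Real.sq_sqrt]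
  nlinarith [norm_nonneg a]

theorem invRadius_ne_zero (ha : a ≠ 0) (ha1 : ‖a‖ < 1) : invRadius a ≠ 0 := by
  have h : 0 < ‖a‖ := norm_pos_iff.2 ha
  have : 0 < invRadius a ^ 2 := by
    rw [invRadius_sq ha1]
    have : 0 < 1 - ‖a‖ ^ 2 := by nlinarith
    positivity
  exact fun h => by simp [h] at this

/-- The right side is also `|1 - āx|²`; this links the inversion to the Clifford expression. -/
theorem norm_sq_mul_norm_sub_invCenter_sq (ha : a ≠ 0) (x : E) :
    (‖a‖ * ‖x - invCenter a‖) ^ 2 = 1 - 2 * ⟪a, x⟫ + ‖a‖ ^ 2 * ‖x‖ ^ 2 := by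
  have h : ‖a‖ ≠ 0 := norm_ne_zero_iff.2 ha
  rw [mul_pow, norm_sub_sq_real, norm_invCenter, invCenter, real_inner_smul_right,
    real_inner_comm]
  field_simp
  ring

theorem norm_invCenter_sub_one_le (x : E) (hx : ‖x‖ ≤ 1) :
    ‖a‖⁻¹ - 1 ≤ ‖x - invCenter a‖ := by
  have := norm_sub_norm_le (invCenter a) x
  rw [norm_invCenter, norm_sub_rev] at this
  linarith

theorem one_lt_inv_norm (ha : a ≠ 0) (ha1 : ‖a‖ < 1) : 1 < ‖a‖⁻¹ :=
  (one_lt_inv₀ (norm_pos_iff.2 ha)).2 ha1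

theorem ne_invCenter (ha : a ≠ 0) (ha1 : ‖a‖ < 1) {x : E} (hx : ‖x‖ ≤ 1) : x ≠ invCenter a := by
  intro h
  have h1 := one_lt_inv_norm ha ha1
  rw [h, norm_invCenter] at hx
  linarith

/-- The sphere of inversion is orthogonal to the unit sphere, `|c|² = 1 + ρ²`, so the inversion
preserves the sign of `1 - |y|²`. -/
theorem one_sub_norm_sq_inversion (ha : a ≠ 0) (ha1 : ‖a‖ < 1) {y : E} (hy : y ≠ invCenter a) :
    1 - ‖inversion (invCenter a) (invRadius a) y‖ ^ 2 =
      invRadius a ^ 2 * (1 - ‖y‖ ^ 2) / ‖y - invCenter a‖ ^ 2 := by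
  have hz : ‖y - invCenter a‖ ≠ 0 := norm_ne_zero_iff.2 (sub_ne_zero.2 hy)
  have h0 : ‖a‖ ≠ 0 := norm_ne_zero_iff.2 ha
  have e1 : ‖invCenter a‖ ^ 2 = 1 + invRadius a ^ 2 := by
    rw [norm_invCenter, invRadius_sq ha1]
    field_simp
    ring
  have e2 : ‖y‖ ^ 2 = ‖y - invCenter a‖ ^ 2 + 2 * ⟪y - invCenter a, invCenter a⟫ +
      ‖invCenter a‖ ^ 2 := by
    rw [← norm_add_sq_real, sub_add_cancel]
  rw [inversion, dist_eq_norm, vsub_eq_sub, vadd_eq_add, norm_add_sq_real, norm_smul,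
    real_inner_smul_left, e2, e1]
  rw [Real.norm_of_nonneg (by positivity)]
  field_simp
  ring

theorem inversion_mem_ball (ha : a ≠ 0) (ha1 : ‖a‖ < 1) {y : E} (hy : y ∈ ball (0 : E) 1) :
    inversion (invCenter a) (invRadius a) y ∈ ball (0 : E) 1 := by
  rw [mem_ball_zero_iff] at hy ⊢
  have hne := ne_invCenter ha ha1 hy.le
  have h := one_sub_norm_sq_inversion ha ha1 hne
  have hz : 0 < ‖y - invCenter a‖ := norm_pos_iff.2 (sub_ne_zero.2 hne)
  have h1 : 0 < 1 - ‖y‖ ^ 2 := by nlinarith [norm_nonneg y]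
  have h2 : 0 < invRadius a ^ 2 := by
    have := invRadius_ne_zero ha ha1
    positivity
  have : 0 < 1 - ‖inversion (invCenter a) (invRadius a) y‖ ^ 2 := by rw [h]; positivity
  nlinarith [norm_nonneg (inversion (invCenter a) (invRadius a) y)]

theorem inversion_zero_eq (ha : a ≠ 0) (ha1 : ‖a‖ < 1) :
    inversion (invCenter a) (invRadius a) 0 = a := by
  have h0 : ‖a‖ ≠ 0 := norm_ne_zero_iff.2 ha
  rw [inversion, dist_eq_norm, zero_sub, norm_neg, norm_invCenter, vsub_eq_sub, vadd_eq_add,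
    div_pow, invRadius_sq ha1, invCenter, zero_sub]
  match_scalars
  field_simp
  ring

theorem norm_inversion (ha : a ≠ 0) (ha1 : ‖a‖ < 1) {x : E} (hx : ‖x‖ ≤ 1) :
    ‖inversion (invCenter a) (invRadius a) x‖ = ‖x - a‖ / (‖a‖ * ‖x - invCenter a‖) := by
  have h0 : ‖a‖ ≠ 0 := norm_ne_zero_iff.2 ha
  have hne := ne_invCenter ha ha1 hx
  have h := dist_inversion_inversion hne (ne_invCenter ha ha1 ha1.le) (invRadius a)
  have e : inversion (invCenter a) (invRadius a) a = 0 := by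
    have := inversion_inversion (invCenter a) (invRadius_ne_zero ha ha1) (0 : E)
    rwa [inversion_zero_eq ha ha1] at this
  have e2 : ‖a - invCenter a‖ = invRadius a ^ 2 * ‖a‖ := by
    have := dist_inversion_center (invCenter a) (0 : E) (invRadius a)
    rw [inversion_zero_eq ha ha1, dist_eq_norm, dist_zero_left, norm_invCenter, div_inv_eq_mul]
      at this
    exact this
  have hρ := invRadius_ne_zero ha ha1
  have hz : ‖x - invCenter a‖ ≠ 0 := norm_ne_zero_iff.2 (sub_ne_zero.2 hne)
  rw [e, dist_zero_right, dist_eq_norm, dist_eq_norm, dist_eq_norm, e2] at h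
  rw [h]
  field_simp

end BallInversion

/-! ### Transporting both bounds from 0 to a -/

section Schwarz

open EuclideanGeometry

variable {E : Type*} [NormedAddCommGroup E] [InnerProductSpace ℝ E] [FiniteDimensional ℝ E]
  {W : Type*} [NormedAddCommGroup W] [InnerProductSpace ℝ W]

/-- The Kelvin transform `|y - c|^{-k} f(y*)`, where `y ↦ y*` is the inversion of the unit ball
exchanging `0` and `a`, and `c` is its centre. -/
noncomputable def kelvin (k : ℕ) (a : E) (f : E → W) (y : E) : W :=
  (‖y - invCenter a‖ ^ 2) ^ (-(k : ℝ) / 2) • f (inversion (invCenter a) (invRadius a) y)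

theorem sq_rpow_neg_half {t : ℝ} (ht : 0 ≤ t) (k : ℕ) : (t ^ 2) ^ (-(k : ℝ) / 2) = (t ^ k)⁻¹ := by
  rw [← Real.rpow_natCast t 2, ← Real.rpow_mul ht, ← Real.rpow_natCast t k, ← Real.rpow_neg ht]
  congr 1
  push_cast
  ring

theorem kelvin_apply (k : ℕ) (a : E) (f : E → W) (y : E) :
    kelvin k a f y =
      (‖y - invCenter a‖ ^ k)⁻¹ • f (inversion (invCenter a) (invRadius a) y) := by
  rw [kelvin, sq_rpow_neg_half (norm_nonneg _)]

variable {f : E → W} {a : E} {k : ℕ}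

theorem harmonicOnNhd_kelvin_ball (hk : Module.finrank ℝ E = k + 2) (ha : a ≠ 0) (ha1 : ‖a‖ < 1)
    (hf : HarmonicOnNhd f (ball 0 1)) : HarmonicOnNhd (kelvin k a f) (ball 0 1) := by
  refine harmonicOnNhd_kelvin isOpen_ball ?_ hf (fun h => ?_) fun y hy =>
    inversion_mem_ball ha ha1 hy
  · rw [hk]; push_cast; ring
  · exact ne_invCenter ha ha1 (mem_ball_zero_iff.1 h).le rfl

theorem norm_kelvin_le (ha : a ≠ 0) (ha1 : ‖a‖ < 1) (hb : ∀ x ∈ ball (0 : E) 1, ‖f x‖ ≤ 1)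
    {y : E} (hy : y ∈ ball (0 : E) 1) : ‖kelvin k a f y‖ ≤ ((‖a‖⁻¹ - 1) ^ k)⁻¹ := by
  have h1 : 0 < ‖a‖⁻¹ - 1 := sub_pos.2 (one_lt_inv_norm ha ha1)
  have h2 := norm_invCenter_sub_one_le (a := a) y (mem_ball_zero_iff.1 hy).le
  rw [kelvin_apply, norm_smul, norm_inv, norm_pow, norm_norm]
  calc _ ≤ ((‖a‖⁻¹ - 1) ^ k)⁻¹ * 1 := by
        gcongr
        exact hb _ (inversion_mem_ball ha ha1 hy)
    _ = _ := mul_one _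

theorem kelvin_zero (ha : a ≠ 0) (ha1 : ‖a‖ < 1) (hfa : f a = 0) : kelvin k a f 0 = 0 := by
  rw [kelvin, inversion_zero_eq ha ha1, hfa, smul_zero]

/-- As `f a = 0`, the product rule leaves only the derivative of the composition; the scale factor
of the inversion at 0 is `ρ² / |c|² = 1 - |a|²`. -/
theorem fderiv_kelvin_zero (ha : a ≠ 0) (ha1 : ‖a‖ < 1) (hf : DifferentiableAt ℝ f a)
    (hfa : f a = 0) (v : E) : fderiv ℝ (kelvin k a f) 0 v =
      ((‖a‖⁻¹ ^ k)⁻¹ * (1 - ‖a‖ ^ 2)) •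
        fderiv ℝ f a ((ℝ ∙ (0 - invCenter a))ᗮ.reflection v) := by
  have hne : (0 : E) ≠ invCenter a := ne_invCenter ha ha1 (by simp)
  have h0 : ‖a‖ ≠ 0 := norm_ne_zero_iff.2 ha
  have hi := hasFDerivAt_inversion (R := invRadius a) hne
  have hf' : HasFDerivAt f (fderiv ℝ f a) (inversion (invCenter a) (invRadius a) 0) := by
    rw [inversion_zero_eq ha ha1]; exact hf.hasFDerivAt
  have hh : DifferentiableAt ℝ (fun y : E => (‖y - invCenter a‖ ^ 2) ^ (-(k : ℝ) / 2)) 0 := by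
    refine DifferentiableAt.rpow_const ((differentiableAt_id.sub_const _).norm_sq ℝ) (Or.inl ?_)
    have := norm_pos_iff.2 (sub_ne_zero.2 hne)
    exact pow_ne_zero 2 this.ne'
  have := (hh.hasFDerivAt.smul (hf'.comp 0 hi)).fderiv
  rw [show kelvin k a f = (fun y : E => (‖y - invCenter a‖ ^ 2) ^ (-(k : ℝ) / 2)) •
    (f ∘ inversion (invCenter a) (invRadius a)) from rfl, this]
  simp only [Function.comp_apply, inversion_zero_eq ha ha1, hfa, add_apply, smul_apply,
    ContinuousLinearMap.smulRight_apply, smul_zero, add_zero, ContinuousLinearMap.comp_apply,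
    map_smul, smul_smul, dist_eq_norm, sq_rpow_neg_half (norm_nonneg _), div_pow, invRadius_sq ha1]
  rw [zero_sub, norm_neg, norm_invCenter]
  congr 1
  field_simp

theorem norm_le_of_harmonicOnNhd_ball_of_apply_eq_zero (hk : Module.finrank ℝ E = k + 2)
    (hf : HarmonicOnNhd f (ball 0 1)) (hb : ∀ x ∈ ball (0 : E) 1, ‖f x‖ ≤ 1) {C : ℝ}
    (hC : Module.finrank ℝ E + 0.35 ≤ C) (ha : a ∈ ball (0 : E) 1) (hfa : f a = 0) {x : E}
    (hx : x ∈ ball (0 : E) 1) :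
    ‖f x‖ ≤ (1 + ‖a‖) ^ k * C *
      (‖x - a‖ / √(1 - 2 * ⟪a, x⟫ + ‖a‖ ^ 2 * ‖x‖ ^ 2) ^ (k + 1)) := by
  -- For `a = 0` the centre `a / |a|²` goes to infinity, and no transform is needed.
  rcases eq_or_ne a 0 with rfl | ha0
  · simpa using norm_le_mul_norm_of_harmonicOnNhd_ball hf hb hfa (by omega) hC hx
  have ha1 : ‖a‖ < 1 := by simpa using ha
  have hx1 : ‖x‖ < 1 := by simpa using hx
  have h0 : 0 < ‖a‖ := norm_pos_iff.2 ha0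
  rw [← norm_sq_mul_norm_sub_invCenter_sq ha0, Real.sqrt_sq (by positivity)]
  have hρ := invRadius_ne_zero ha0 ha1
  set y := inversion (invCenter a) (invRadius a) x with hy
  have hyb : y ∈ ball (0 : E) 1 := inversion_mem_ball ha0 ha1 hx
  have hxy : inversion (invCenter a) (invRadius a) y = x := inversion_inversion _ hρ _
  have h1 := norm_le_mul_norm_of_harmonicOnNhd_ball (harmonicOnNhd_kelvin_ball hk ha0 ha1 hf)
    (fun y hy => norm_kelvin_le ha0 ha1 hb hy) (kelvin_zero ha0 ha1 hfa) (by omega) hC hyb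
  have hne := ne_invCenter ha0 ha1 hx1.le
  have hz : 0 < ‖x - invCenter a‖ := norm_pos_iff.2 (sub_ne_zero.2 hne)
  have hyc : ‖y - invCenter a‖ = invRadius a ^ 2 / ‖x - invCenter a‖ := by
    rw [← dist_eq_norm, hy, dist_inversion_center, dist_eq_norm]
  have hyc0 : 0 < ‖y - invCenter a‖ := by rw [hyc]; positivity
  rw [kelvin_apply, hxy, norm_smul, norm_inv, norm_pow, norm_norm, inv_mul_le_iff₀ (by positivity),
    norm_inversion ha0 ha1 hx1.le] at h1
  refine h1.trans (le_of_eq ?_)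
  -- The factor `‖a‖⁻¹ - 1` cancels against the bound on the Kelvin transform and leaves the power
  -- of `1 + ‖a‖`.
  have h2 : ‖y - invCenter a‖ = (‖a‖⁻¹ - 1) * ((1 + ‖a‖) / (‖a‖ * ‖x - invCenter a‖)) := by
    rw [hyc, invRadius_sq ha1]
    field_simp
    ring
  have h3 : 0 < ‖a‖⁻¹ - 1 := sub_pos.2 (one_lt_inv_norm ha0 ha1)
  rw [h2, mul_pow, div_pow, pow_succ]
  clear_value y
  generalize ‖a‖⁻¹ - 1 = q at h3 ⊢
  field_simp

theorem sqrt_sum_norm_sq_fderiv_le [CompleteSpace W] (hk : Module.finrank ℝ E = k + 2)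
    (hf : HarmonicOnNhd f (ball 0 1)) (hb : ∀ x ∈ ball (0 : E) 1, ‖f x‖ ≤ 1) {C : ℝ}
    (hC : Module.finrank ℝ E + 0.35 ≤ C) (ha : a ∈ ball (0 : E) 1) (hfa : f a = 0)
    {ι : Type*} [Fintype ι] (e : OrthonormalBasis ι ℝ E) :
    √(∑ i, ‖fderiv ℝ f a (e i)‖ ^ 2) ≤ C * (1 / ((1 + ‖a‖) * (1 - ‖a‖) ^ (k + 1))) := by
  have hN : (Module.finrank ℝ E : ℝ) = k + 2 := by rw [hk]; push_cast; ring
  have hk0 : (0 : ℝ) ≤ k := Nat.cast_nonneg k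
  have hC0 : 0 ≤ C := by rw [hN] at hC; norm_num at hC; linarith
  -- Already `(N + 0.35) ^ 2 ≥ N + 3` for `N ≥ 2`.
  have hC2 : (Module.finrank ℝ E : ℝ) + 3 ≤ C ^ 2 := by
    rw [hN] at hC ⊢
    norm_num at hC
    nlinarith
  have ha1 : ‖a‖ < 1 := by simpa using ha
  have h1a : 0 < 1 - ‖a‖ := sub_pos.2 ha1
  refine Real.sqrt_le_iff.2 ⟨by positivity, ?_⟩
  rcases eq_or_ne a 0 with rfl | ha0
  · have := sum_norm_sq_fderiv_le hf hb e
    simp only [norm_zero, add_zero, sub_zero, one_pow, mul_one, div_one] at this ⊢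
    exact this.trans hC2
  have h0 : 0 < ‖a‖ := norm_pos_iff.2 ha0
  set σ := (ℝ ∙ (0 - invCenter a))ᗮ.reflection with hσ
  -- In the reflected basis, the reflection in the derivative of the inversion undoes itself.
  have h := sum_norm_sq_fderiv_le (harmonicOnNhd_kelvin_ball hk ha0 ha1 hf)
    (fun y hy => norm_kelvin_le ha0 ha1 hb hy) (e.map σ)
  have hσσ : ∀ v, σ (σ v) = v := Submodule.reflection_reflection _
  have h2a : 0 < 1 - ‖a‖ ^ 2 := by nlinarith
  simp only [fderiv_kelvin_zero ha0 ha1 ((hf a ha).1.differentiableAt (by norm_num)) hfa,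
    OrthonormalBasis.map_apply, ← hσ, hσσ, norm_smul, mul_pow, ← Finset.mul_sum] at h
  have h3 : 0 < ‖a‖⁻¹ - 1 := sub_pos.2 (one_lt_inv_norm ha0 ha1)
  set S := ∑ i, ‖fderiv ℝ f a (e i)‖ ^ 2
  have h4 : ‖(‖a‖⁻¹ ^ k)⁻¹ * (1 - ‖a‖ ^ 2)‖ = ‖a‖ ^ k * (1 - ‖a‖ ^ 2) := by
    rw [inv_pow, inv_inv, Real.norm_of_nonneg (by positivity)]
  have h5 : ‖a‖⁻¹ - 1 = (1 - ‖a‖) / ‖a‖ := by field_simp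
  rw [h4, h5] at h
  have h6 : (‖a‖ ^ k * (1 - ‖a‖ ^ 2)) ^ 2 * S ≤ C ^ 2 * ((((1 - ‖a‖) / ‖a‖) ^ k)⁻¹) ^ 2 :=
    h.trans (mul_le_mul_of_nonneg_right hC2 (by positivity))
  rw [← le_div_iff₀' (by positivity)] at h6
  refine h6.trans (le_of_eq ?_)
  have h7 : 1 - ‖a‖ ^ 2 = (1 + ‖a‖) * (1 - ‖a‖) := by ring
  rw [h7, div_pow, pow_succ (1 - ‖a‖) k]
  field_simp

end Schwarz

/-! ### Dimension one, where harmonic functions are affine -/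

section OneDimensional

variable {E : Type*} [NormedAddCommGroup E] [InnerProductSpace ℝ E] [FiniteDimensional ℝ E]
  {W : Type*} [NormedAddCommGroup W] [NormedSpace ℝ W] {f : E → W} {a : E}

theorem exists_eq_smul_of_finrank_eq_one (hE : Module.finrank ℝ E = 1) :
    ∃ u : E, ‖u‖ = 1 ∧ (∀ v : E, ∃ t : ℝ, v = t • u) ∧
      ∀ (g : E → W) (x : E), Δ g x = secondDeriv g x u := by
  set b := (stdOrthonormalBasis ℝ E).reindex (finCongr hE)
  refine ⟨b 0, b.orthonormal.1 0, fun v => ⟨⟪b 0, v⟫, ?_⟩, fun g x => ?_⟩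
  · simpa using (b.sum_repr' v).symm
  · rw [laplacian_eq_sum_secondDeriv b]
    simp

theorem eq_fderiv_apply_sub_of_finrank_eq_one (hE : Module.finrank ℝ E = 1)
    (hf : HarmonicOnNhd f (ball 0 1)) (ha : a ∈ ball (0 : E) 1) (hfa : f a = 0) {x : E}
    (hx : x ∈ ball (0 : E) 1) : f x = fderiv ℝ f a (x - a) := by
  obtain ⟨u, -, hu, hΔ⟩ := exists_eq_smul_of_finrank_eq_one (E := E) (W := W) hE
  have hpre : IsPreconnected (ball (0 : E) 1) := (convex_ball 0 1).isPreconnected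
  have h2 : ∀ y ∈ ball (0 : E) 1, fderiv ℝ (fderiv ℝ f) y = 0 := by
    intro y hy
    have h := (hf y hy).2.self_of_nhds
    rw [hΔ, secondDeriv] at h
    ext v w
    obtain ⟨s, rfl⟩ := hu v
    obtain ⟨t, rfl⟩ := hu w
    simp [h]
  have h1 : ∀ y ∈ ball (0 : E) 1, fderiv ℝ f y = fderiv ℝ f a := fun y hy =>
    isOpen_ball.is_const_of_fderiv_eq_zero hpre
      (fun y hy => (differentiableAt_fderiv (hf y hy).1).differentiableWithinAt) h2 hy ha
  have hg : ∀ y ∈ ball (0 : E) 1,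
      HasFDerivAt (fun y => f y - fderiv ℝ f a (y - a)) (0 : E →L[ℝ] W) y := by
    intro y hy
    have h3 := ((hf y hy).1.differentiableAt (by norm_num)).hasFDerivAt
    have h4 := (fderiv ℝ f a).hasFDerivAt.comp y ((hasFDerivAt_id y).sub_const a)
    refine (h3.sub h4).congr_fderiv ?_
    rw [h1 y hy]
    ext v
    simp
  have := isOpen_ball.is_const_of_fderiv_eq_zero hpre
    (fun y hy => (hg y hy).differentiableAt.differentiableWithinAt)
    (fun y hy => (hg y hy).fderiv) hx ha
  simpa [hfa, sub_eq_zero] using this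

theorem norm_fderiv_apply_le_of_finrank_eq_one (hE : Module.finrank ℝ E = 1)
    (hf : HarmonicOnNhd f (ball 0 1)) (hb : ∀ x ∈ ball (0 : E) 1, ‖f x‖ ≤ 1)
    (ha : a ∈ ball (0 : E) 1) (hfa : f a = 0) (v : E) :
    ‖fderiv ℝ f a v‖ ≤ (1 + ‖a‖)⁻¹ * ‖v‖ := by
  obtain ⟨u, hu1, hu, -⟩ := exists_eq_smul_of_finrank_eq_one (E := E) (W := W) hE
  -- `w` points away from `a`, so that `t • w - a` has length `t + ‖a‖`; letting `t` tend to 1 gives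
  -- the factor `1 + ‖a‖`.
  obtain ⟨w, hw1, hw⟩ : ∃ w : E, ‖w‖ = 1 ∧ (∃ s : ℝ, |s| = 1 ∧ u = s • w) ∧
      a = -(‖a‖ • w) := by
    obtain ⟨t, rfl⟩ := hu a
    rw [norm_smul, hu1, mul_one, Real.norm_eq_abs]
    rcases abs_cases t with ⟨h, -⟩ | ⟨h, -⟩
    · exact ⟨-u, by simpa using hu1, ⟨-1, by simp, by simp⟩, by rw [h]; simp⟩
    · exact ⟨u, hu1, ⟨1, by simp, by simp⟩, by rw [h]; simp⟩
  obtain ⟨⟨s, hs, rfl⟩, haw⟩ := hw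
  have key : (1 + ‖a‖) * ‖fderiv ℝ f a w‖ ≤ 1 := by
    have hc : Tendsto (fun t : ℝ => (t + ‖a‖) * ‖fderiv ℝ f a w‖) (𝓝[<] 1)
        (𝓝 ((1 + ‖a‖) * ‖fderiv ℝ f a w‖)) := by
      have : Continuous (fun t : ℝ => (t + ‖a‖) * ‖fderiv ℝ f a w‖) := by fun_prop
      exact (this.tendsto 1).mono_left nhdsWithin_le_nhds
    refine le_of_tendsto hc ?_
    filter_upwards [Ioo_mem_nhdsLT (zero_lt_one' ℝ)] with t ht
    have htw : t • w ∈ ball (0 : E) 1 := by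
      rw [mem_ball_zero_iff, norm_smul, hw1, mul_one, Real.norm_of_nonneg ht.1.le]
      exact ht.2
    have h1 := hb _ htw
    rw [eq_fderiv_apply_sub_of_finrank_eq_one hE hf ha hfa htw] at h1
    have h2 : t • w - a = (t + ‖a‖) • w := by
      conv_lhs => rw [haw]
      module
    have := ht.1
    rw [h2, map_smul, norm_smul, Real.norm_of_nonneg (by positivity)] at h1
    exact h1
  obtain ⟨t, rfl⟩ := hu v
  rw [smul_smul, map_smul, norm_smul, norm_smul, hw1, mul_one, mul_comm]
  gcongr
  rw [← one_div, le_div_iff₀' (by positivity)]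
  exact key

end OneDimensional

/-! ### Comparison of N + 0.35 with 1 / (2^(1/N) - 1) -/

section Constant

theorem one_add_mul_add_le_pow {x : ℝ} (hx : 0 ≤ x) (m : ℕ) :
    1 + m * x + m * (m - 1) / 2 * x ^ 2 ≤ (1 + x) ^ m := by
  induction m with
  | zero => simp
  | succ m ih =>
    have hm : (0 : ℝ) ≤ m * (m - 1) / 2 * x ^ 3 := by
      rcases m with _ | m
      · simp
      · have : (((m + 1 : ℕ) : ℝ) - 1) = m := by push_cast; ring
        rw [this]
        positivity
    have := mul_le_mul_of_nonneg_right ih (by linarith : (0 : ℝ) ≤ 1 + x)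
    rw [pow_succ (1 + x)]
    push_cast
    refine le_trans ?_ this
    linear_combination hm

/-- Equivalent to `2 ≤ (1 + 1 / (N + 0.35)) ^ N`. The binomial expansion to second order suffices
for `N ≥ 2`. -/
theorem add_le_one_div_two_rpow_sub_one {n : ℕ} (hn : 1 ≤ n) :
    ((n : ℝ) + 1) + 0.35 ≤ 1 / ((2 : ℝ) ^ (1 / ((n : ℝ) + 1)) - 1) := by
  have hn' : (1 : ℝ) ≤ n := by exact_mod_cast hn
  set N : ℝ := n + 1
  have hN : 2 ≤ N := by simp only [N]; linarith
  have h1 : 1 < (2 : ℝ) ^ (1 / N) := Real.one_lt_rpow (by norm_num) (by positivity)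
  have h2 : (2 : ℝ) ≤ (1 + 1 / (N + 0.35)) ^ (n + 1) := by
    refine le_trans ?_ (one_add_mul_add_le_pow (by positivity) (n + 1))
    have e : ((n + 1 : ℕ) : ℝ) = N := by push_cast; rfl
    rw [e]
    norm_num only
    have : 2 ≤ 1 + N * (1 / (N + 7 / 20)) + N * (N - 1) / 2 * (1 / (N + 7 / 20)) ^ 2 := by
      have h3 : 0 < N + 7 / 20 := by positivity
      have e2 : 1 + N * (1 / (N + 7 / 20)) + N * (N - 1) / 2 * (1 / (N + 7 / 20)) ^ 2 - 2 =
          (N ^ 2 / 2 - 17 / 20 * N - 49 / 400) / (N + 7 / 20) ^ 2 := by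
        field_simp
        ring
      have h4 : 0 ≤ (N ^ 2 / 2 - 17 / 20 * N - 49 / 400) / (N + 7 / 20) ^ 2 := by
        apply div_nonneg _ (by positivity)
        nlinarith
      linarith
    exact this
  have h3 : (2 : ℝ) ^ (1 / N) ≤ 1 + 1 / (N + 0.35) := by
    calc (2 : ℝ) ^ (1 / N) ≤ ((1 + 1 / (N + 0.35)) ^ (n + 1)) ^ (1 / N) := by gcongr
      _ = 1 + 1 / (N + 0.35) := by
        rw [← Real.rpow_natCast, ← Real.rpow_mul (by positivity)]
        have : ((n + 1 : ℕ) : ℝ) * (1 / N) = 1 := by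
          push_cast
          exact mul_one_div_cancel (by positivity)
        rw [this, Real.rpow_one]
  rw [le_div_iff₀ (by linarith)]
  calc (N + 0.35) * ((2 : ℝ) ^ (1 / N) - 1) ≤ (N + 0.35) * (1 / (N + 0.35)) := by
        gcongr
        linarith
    _ = 1 := mul_one_div_cancel (by positivity)

end Constant

/-! ### Passage to Euclidean coordinates and the final theorem -/

section Transfer

open CliffordHarmonic

/-- The coordinates as a linear isometry. -/
noncomputable def coordsIsometry (n : ℕ) : Cl n ≃ₗᵢ[ℝ] EuclideanSpace ℝ (Finset (Fin n)) :=
  { coords n with norm_map' := norm_coords }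

end Transfer

end HarmonicBall


open HarmonicBall in
/-- `star` on `Cl n` is the Clifford conjugation; the exponent `n - 1` is taken in `ℤ`. -/
theorem mainTheorem3 (n : ℕ)
    (f : EuclideanSpace ℝ (Fin (n + 1)) → CliffordHarmonic.Cl n)
    (hf : InnerProductSpace.HarmonicOnNhd f (Metric.ball 0 1))
    (hbound : ∀ x ∈ Metric.ball (0 : EuclideanSpace ℝ (Fin (n + 1))) 1, ‖f x‖ ≤ 1)
    (a : EuclideanSpace ℝ (Fin (n + 1))) (ha : a ∈ Metric.ball 0 1) (hfa : f a = 0) :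
    (∀ x ∈ Metric.ball (0 : EuclideanSpace ℝ (Fin (n + 1))) 1,
      ‖f x‖ ≤ (1 + ‖a‖) ^ ((n : ℤ) - 1) / ((2 : ℝ) ^ (1 / ((n : ℝ) + 1)) - 1) *
        (‖x - a‖ / ‖1 - star (CliffordHarmonic.paravector a) *
          CliffordHarmonic.paravector x‖ ^ n)) ∧
    CliffordHarmonic.gradNorm f a ≤
      1 / ((2 : ℝ) ^ (1 / ((n : ℝ) + 1)) - 1) * (1 / ((1 + ‖a‖) * (1 - ‖a‖) ^ n)) := by
  rcases n with _ | k
  · have hE : Module.finrank ℝ (EuclideanSpace ℝ (Fin (0 + 1))) = 1 := by simp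
    have h := norm_fderiv_apply_le_of_finrank_eq_one hE hf hbound ha hfa
    have h1 : (2 : ℝ) ^ (1 / (((0 : ℕ) : ℝ) + 1)) - 1 = 1 := by norm_num
    constructor
    · intro x hx
      rw [eq_fderiv_apply_sub_of_finrank_eq_one hE hf ha hfa hx, h1]
      simpa using h (x - a)
    · rw [h1]
      have h2 := h (EuclideanSpace.single 0 1)
      simp only [PiLp.norm_single, norm_one, mul_one] at h2
      simpa [CliffordHarmonic.gradNorm, Real.sqrt_sq] using h2
  · have hE : Module.finrank ℝ (EuclideanSpace ℝ (Fin (k + 1 + 1))) = k + 2 := by simp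
    have hC := add_le_one_div_two_rpow_sub_one (n := k + 1) (by omega)
    have hC' : (Module.finrank ℝ (EuclideanSpace ℝ (Fin (k + 1 + 1))) : ℝ) + 0.35 ≤
        1 / ((2 : ℝ) ^ (1 / (((k + 1 : ℕ) : ℝ) + 1)) - 1) := by
      rw [hE]
      refine le_trans (le_of_eq ?_) hC
      push_cast
      ring
    -- The bounds above need an inner product on the target, which the coordinate space provides.
    set L := coordsIsometry (k + 1)
    have hg : InnerProductSpace.HarmonicOnNhd (fun x => L (f x)) (Metric.ball 0 1) :=
      hf.comp_CLM (L.toContinuousLinearEquiv : CliffordHarmonic.Cl (k + 1) →L[ℝ]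
        EuclideanSpace ℝ (Finset (Fin (k + 1))))
    have hgb : ∀ x ∈ Metric.ball (0 : EuclideanSpace ℝ (Fin (k + 1 + 1))) 1, ‖L (f x)‖ ≤ 1 :=
      fun x hx => by rw [L.norm_map]; exact hbound x hx
    have hga : L (f a) = 0 := by rw [hfa, map_zero]
    constructor
    · intro x hx
      have h := norm_le_of_harmonicOnNhd_ball_of_apply_eq_zero hE hg hgb hC' ha hga hx
      rw [L.norm_map, ← norm_sq_one_sub_star_paravector_mul,
        Real.sqrt_sq (norm_nonneg _)] at h
      have e : (((k + 1 : ℕ) : ℤ) - 1) = (k : ℤ) := by push_cast; ring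
      rw [e, zpow_natCast, div_eq_mul_one_div]
      exact h
    · have h := sqrt_sum_norm_sq_fderiv_le hE hg hgb hC' ha hga
        (EuclideanSpace.basisFun (Fin (k + 1 + 1)) ℝ)
      have hd : ∀ v, ‖fderiv ℝ (fun x => L (f x)) a v‖ = ‖fderiv ℝ f a v‖ := by
        intro v
        have := L.comp_fderiv (f := f) (x := a)
        rw [show (fun x => L (f x)) = L ∘ f from rfl, this]
        exact L.norm_map _
      simp only [hd, EuclideanSpace.basisFun_apply] at h
      exact h
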